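/- For $t>0$ let $v_{\alpha,\beta}(t,\cdot)$ be the stable density with $\int_{\mathbb R} e^{i\omega x}v_{\alpha,\beta}(t,x)\,dx=\exp\bigl(-t|\omega|^{\alpha}e^{\frac{i\pi}{2}\beta\,\mathrm{sgn}\,\omega}\bigr)$, i.e. $v_{\alpha,\beta}(t,x)=\frac1{2\pi}\int_{\mathbb R} e^{-i\omega x}\exp\bigl(-t|\omega|^{\alpha}e^{\frac{i\pi}{2}\beta\,\mathrm{sgn}\,\omega}\bigr)d\omega$, where either $0<\alpha<1$ and $|\beta|\le\alpha$, or $1<\alpha\le2$ and $|\beta|\le2-\alpha$. Let $\alpha_1=l/k$, $\beta_1=(l-2a)/k$, $\alpha_2=p/q$, $\beta_2=(p-2b)/q$ with positive integers $l,k,p,q$ and integers $a,b$, where both pairs $(\alpha_j,\beta_j)$ satisfy these conditions and $\alpha_1\ne\alpha_2$. Let $H(t,x)=\int_{\mathbb R}v_{\alpha_1,\beta_1}(t,y)\,v_{\alpha_2,\beta_2}(t,x-y)\,dy$ be the density of the sum of two independent variables with these densities. Put $$m=\min(\alpha_1,\alpha_2),\quad M=\max(\alpha_1,\alpha_2),\quad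 m_1=\min(kp,lq),$$ $$(u,v)=\Bigl(\frac ak,\frac bq\Bigr)\ \text{if }\alpha_1>\alpha_2,\qquad (u,v)=\Bigl(\frac bq,\frac ak\Bigr)\ \text{if }\alpha_1<\alpha_2 .$$ Assume $u>0$. Then $um_1$ is a positive integer. For an integer $n\ge1$ let $\Delta(n,c)$ denote the list $\frac cn,\frac{c+1}n,\dots,\frac{c+n-1}n$. Let $$G^{\mu,\nu}_{P,Q}\Bigl(z\Big|{A_1,\dots,A_P\atop B_1,\dots,B_Q}\Bigr)=\frac1{2\pi i}\int_{L}z^{-s}\,\frac{\prod_{j=1}^{\mu}\Gamma(B_j+s)\prod_{j=1}^{\nu}\Gamma(1-A_j-s)}{\prod_{j=\mu+1}^{Q}\Gamma(1-B_j-s)\prod_{j=\nu+1}^{P}\Gamma(A_j+s)}\,ds$$ be the Meijer function, where $L$ is an upward vertical line that has the poles of $\Gamma(B_j+s)$, $j\le\mu$, on its left and those of $\Gamma(1-A_j-s)$, $j\le\nu$, on its right. Then for all $t>0$ and $x>0$ one has $H(t,x)=H_+(t,x)$, where $$H_+(t,x)=\frac1\pi\,\mathrm{Re}\int_0^\infty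 e^{-ix\omega}\exp\Bigl(-t\omega^{\alpha_1}e^{\frac{i\pi}2\beta_1}-t\omega^{\alpha_2}e^{\frac{i\pi}2\beta_2}\Bigr)d\omega ,$$ and $$H_+(t,x)=\frac{m_1\sqrt M}{x\,(2\pi)^{\frac{lp+m_1}2-um_1}}\sum_{r=0}^\infty\frac{(-t)^r}{r!}\Bigl(\frac{m_1}t\Bigr)^{\frac mM r}G^{m_1,\,lp}_{lp+um_1,\,m_1+um_1}\left(\frac{(lp)^{lp}\,t^{m_1}}{x^{lp}\,m_1^{m_1}}\Big|{\Delta(lp,0),\ \Delta\bigl(um_1,-(v-u\frac mM)r\bigr)\atop\Delta\bigl(m_1,\frac mM r\bigr),\ \Delta\bigl(um_1,-(v-u\frac mM)r\bigr)}\right).$$ The series converges absolutely. For each $r$ a line $L$ as above exists, and the integral that defines the Meijer function converges absolutely on every such line, with a value that does not depend on the line. -/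

import Mathlib

namespace TwoScaleStable

noncomputable section

open MeasureTheory

/-- Admissible index `α` and skewness `β` of a stable law. -/
def Admissible (α β : ℝ) : Prop :=
  (0 < α ∧ α < 1 ∧ |β| ≤ α) ∨ (1 < α ∧ α ≤ 2 ∧ |β| ≤ 2 - α)

/-- Characteristic function `ω ↦ exp (-t |ω|^α e^{(iπ/2) β sgn ω})` of the stable law. -/
def stableChar (α β t ω : ℝ) : ℂ :=
  Complex.exp (-((t * |ω| ^ α : ℝ) : ℂ) *
    Complex.exp (((Real.pi / 2 * β * Real.sign ω : ℝ) : ℂ) * Complex.I))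

/-- The stable density `v_{α,β}(t, x) = (2π)⁻¹ ∫ e^{-iωx} exp (-t |ω|^α e^{(iπ/2) β sgn ω}) dω`.
The integral is a real number, since the characteristic function at `-ω` is the complex conjugate
of the one at `ω`. -/
def stableDensity (α β t x : ℝ) : ℝ :=
  (1 / (2 * (Real.pi : ℂ)) *
    ∫ ω : ℝ, Complex.exp (-(((ω * x : ℝ) : ℂ) * Complex.I)) * stableChar α β t ω).re

/-- The density `H(t, x)` of the sum of two independent stable variables: the convolution of
their densities. -/
def sumDensity (α₁ β₁ α₂ β₂ t x : ℝ) : ℝ :=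
  ∫ y : ℝ, stableDensity α₁ β₁ t y * stableDensity α₂ β₂ t (x - y)

/-- `H₊(t, x) = π⁻¹ Re ∫_0^∞ e^{-ixω} exp (-t ω^α₁ e^{iπβ₁/2} - t ω^α₂ e^{iπβ₂/2}) dω`. -/
def sumDensityPos (α₁ β₁ α₂ β₂ t x : ℝ) : ℝ :=
  1 / Real.pi * (∫ ω in Set.Ioi (0 : ℝ), Complex.exp (-(((x * ω : ℝ) : ℂ) * Complex.I)) *
    Complex.exp
      (-((t * ω ^ α₁ : ℝ) : ℂ) * Complex.exp (((Real.pi / 2 * β₁ : ℝ) : ℂ) * Complex.I)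
        - ((t * ω ^ α₂ : ℝ) : ℂ) * Complex.exp (((Real.pi / 2 * β₂ : ℝ) : ℂ) * Complex.I))).re

/-- The list `Δ(n, a) = (a/n, (a+1)/n, …, (a+n-1)/n)`. -/
def Δ (n : ℕ) (a : ℂ) : Fin n → ℂ := fun j => (a + (j : ℕ)) / n

/-- The quotient of Gamma functions whose inverse Mellin transform is `G^{m,n}_{p,q}`. At a pole
of a Gamma function in the denominator the value is `0`, as it has to be, since
`Complex.Gamma` is `0` there in Mathlib and `0⁻¹ = 0`. -/
def meijerGKernel (m n p q : ℕ) (A : Fin p → ℂ) (B : Fin q → ℂ) (s : ℂ) : ℂ :=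
  ((∏ j : Fin q with j.val < m, Complex.Gamma (B j + s)) *
      ∏ j : Fin p with j.val < n, Complex.Gamma (1 - A j - s)) /
    ((∏ j : Fin q with m ≤ j.val, Complex.Gamma (1 - B j - s)) *
      ∏ j : Fin p with n ≤ j.val, Complex.Gamma (A j + s))

/-- The vertical line `Re s = c` has all the poles of `Γ(B_j + s)`, `j ≤ m`, strictly on its left
and all the poles of `Γ(1 - A_j - s)`, `j ≤ n`, strictly on its right. -/
def SeparatesPoles (m n p q : ℕ) (A : Fin p → ℂ) (B : Fin q → ℂ) (c : ℝ) : Prop :=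
  (∀ j : Fin q, (j : ℕ) < m → -(B j).re < c) ∧ ∀ j : Fin p, (j : ℕ) < n → c < 1 - (A j).re

/-- The Mellin–Barnes integrand `z^{-s} × kernel` at the point `s = c + iy` of the line. -/
def meijerGIntegrand (m n p q : ℕ) (z : ℂ) (A : Fin p → ℂ) (B : Fin q → ℂ) (c y : ℝ) : ℂ :=
  z ^ (-((c : ℂ) + y * Complex.I)) * meijerGKernel m n p q A B ((c : ℂ) + y * Complex.I)

/-- `(2πi)⁻¹ ∫ z^{-s} × kernel ds` along the line `Re s = c` (with `ds = i dy`). -/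
def meijerGLine (m n p q : ℕ) (z : ℂ) (A : Fin p → ℂ) (B : Fin q → ℂ) (c : ℝ) : ℂ :=
  1 / (2 * (Real.pi : ℂ)) * ∫ y : ℝ, meijerGIntegrand m n p q z A B c y

open Classical in
/-- The Meijer function `G^{m,n}_{p,q}(z | A ; B)` as an inverse Mellin transform along a vertical
line that separates the two families of poles; see `MeijerGWellDefined`. -/
def meijerG (m n p q : ℕ) (z : ℂ) (A : Fin p → ℂ) (B : Fin q → ℂ) : ℂ :=
  if h : ∃ c : ℝ, SeparatesPoles m n p q A B c then meijerGLine m n p q z A B h.choose else 0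

/-- A separating vertical line exists, the Mellin–Barnes integral converges absolutely on each
such line, and its value does not depend on the line. -/
def MeijerGWellDefined (m n p q : ℕ) (z : ℂ) (A : Fin p → ℂ) (B : Fin q → ℂ) : Prop :=
  (∃ c : ℝ, SeparatesPoles m n p q A B c) ∧
    ∀ c : ℝ, SeparatesPoles m n p q A B c →
      Integrable (meijerGIntegrand m n p q z A B c) ∧
        meijerGLine m n p q z A B c = meijerG m n p q z A B

/-- Upper parameters `Δ(lp, 0), Δ(N, -(v - u m / M) r)`, where `L = lp`. -/
def upperParams (L N : ℕ) (m M u v : ℝ) (r : ℕ) : Fin (L + N) → ℂ :=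
  Fin.append (Δ L 0) (Δ N ((-(v - u * (m / M)) * r : ℝ) : ℂ))

/-- Lower parameters `Δ(m₁, (m / M) r), Δ(N, -(v - u m / M) r)`. -/
def lowerParams (m₁ N : ℕ) (m M u v : ℝ) (r : ℕ) : Fin (m₁ + N) → ℂ :=
  Fin.append (Δ m₁ ((m / M * r : ℝ) : ℂ)) (Δ N ((-(v - u * (m / M)) * r : ℝ) : ℂ))

/-- The `r`-th Meijer function `G^{m₁, L}_{L + N, m₁ + N}` of the series, where `L = lp`, at the
argument `L^L t^m₁ / (x^L m₁^m₁)`. -/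
def seriesG (L m₁ N : ℕ) (m M u v t x : ℝ) (r : ℕ) : ℂ :=
  meijerG m₁ L (L + N) (m₁ + N) (((L : ℝ) ^ L * t ^ m₁ / (x ^ L * (m₁ : ℝ) ^ m₁) : ℝ) : ℂ)
    (upperParams L N m M u v r) (lowerParams m₁ N m M u v r)

/-- The `r`-th term `((-t)^r / r!) (m₁ / t)^{(m / M) r} G_r` of the series. -/
def seriesTerm (L m₁ N : ℕ) (m M u v t x : ℝ) (r : ℕ) : ℂ :=
  (((-t) ^ r / (r.factorial : ℝ) * ((m₁ : ℝ) / t) ^ (m / M * r) : ℝ) : ℂ) *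
    seriesG L m₁ N m M u v t x r

end

end TwoScaleStable

/-!
The density `H` is the inverse Fourier transform of the product of the two characteristic functions,
and this product takes conjugate values at `ω` and `-ω`, so `H = H₊`
(`sumDensity_eq_sumDensityPos`). The densities need not be handled as functions in `L¹`: Parseval's
identity on `L¹ ∩ L²` gives the convolution theorem (`integral_fourier_mul_fourier_sub`).

Let `M > m` be the two indices, so that the two skewnesses are `M - 2u` and `m - 2v`. In `H₊` the
factor `exp (-t ω^m e^{iπ(m - 2v)/2})` is expanded in powers of `ω^m`. As `|M - 2u| < 1`, the other
factor decays like `exp (-c ω^M)` and dominates `exp (t ω^m)`, so that the sum and the integral can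
be exchanged (`hasSum_expansionTerm`). This leaves the integrals
`∫_0^∞ e^{-ixω} ω^{mr} exp (-t ω^M e^{iπ(M - 2u)/2}) dω`.

Such an integral is evaluated by Mellin's inversion formula for `exp` along a ray
(`integral_Gamma_mul_cpow`), which rests on the exponential decay of `Γ` on vertical lines
(`exists_norm_Gamma_le`). Replacing `e^{-ixω}` by `e^{-(ε + ix)ω}` makes Fubini's theorem
applicable, and `ε → 0` gives a Mellin–Barnes integral with `Γ(w) Γ(1 + mr - Mw)`
(`integral_fourier_eq_barnes`). Its integrand is conjugate-symmetric apart from a factor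
`-i e^{iπ(uw - vr)}`, so taking the real part produces `sin (π(uw - vr))`
(`re_integral_fourier_eq_sine`).

The Meijer kernel of the series is the same thing: Gauss's multiplication formula
(`prod_Gamma_add_div`) collapses the products over `Δ(m₁, ·)` and `Δ(lp, 0)` to one Gamma factor
each, and the reflection formula with the multiplication formula for the sine
(`prod_sin_pi_mul_add_div`) collapses the denominator to a sine (`meijerGKernel_series`). The two
integrals agree under `w = m₁ s + (m / M) r`, on every separating line. The value found does not
mention the line, so it is independent of the line, and no shift of contours is needed
(`meijerGLine_series`).
-/

namespace TwoScaleStable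

/-! ### The multiplication formulas for the sine and the Gamma function -/

open Finset in
/-- `sin (π (z + j / n))` is, up to an exponential factor, `1 - ζ ^ j e^{2πiz}` with `ζ` a primitive
`n`-th root of unity, so this is the factorisation of `1 - X ^ n`. -/
theorem prod_sin_pi_mul_add_div {n : ℕ} (hn : 0 < n) (z : ℂ) :
    ∏ j ∈ range n, Complex.sin (Real.pi * (z + j / n)) =
      2 / 2 ^ n * Complex.sin (Real.pi * (n * z)) := by
  obtain ⟨k, rfl⟩ : ∃ k, n = k + 1 := ⟨n - 1, by omega⟩
  have hn0 : ((k + 1 : ℕ) : ℂ) ≠ 0 := by exact_mod_cast hn.ne'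
  set ζ := Complex.exp (2 * Real.pi * Complex.I / (k + 1 : ℕ)) with hζ
  have hprim : IsPrimitiveRoot ζ (k + 1) := Complex.isPrimitiveRoot_exp _ hn.ne'
  set w := Complex.exp (2 * Real.pi * Complex.I * z) with hw
  have hroots : ∏ j ∈ range (k + 1), (1 - ζ ^ j * w) = 1 - w ^ (k + 1) := by
    have h := congrArg (Polynomial.eval 1) (X_pow_sub_C_eq_prod hprim hn (α := w) rfl)
    simpa [Polynomial.eval_prod] using h.symm
  -- `sin θ = (i / 2) e^{-iθ} (1 - e^{2iθ})` at `θ = π (z + j / n)`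
  have hfac : ∀ j ∈ range (k + 1), Complex.sin (Real.pi * (z + j / (k + 1 : ℕ))) =
      Complex.I / 2 * Complex.exp (-(Real.pi * z * Complex.I)) *
        Complex.exp (-(Real.pi * Complex.I / (k + 1 : ℕ)) * j) * (1 - ζ ^ j * w) := by
    intro j _
    have h1 : ζ ^ j * w = Complex.exp (Real.pi * (z + j / (k + 1 : ℕ)) * Complex.I) *
        Complex.exp (Real.pi * (z + j / (k + 1 : ℕ)) * Complex.I) := by
      rw [hζ, hw, ← Complex.exp_nat_mul, ← Complex.exp_add, ← Complex.exp_add]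
      congr 1
      ring
    have h2 : Complex.exp (-(Real.pi * z * Complex.I)) *
        Complex.exp (-(Real.pi * Complex.I / (k + 1 : ℕ)) * j) =
        Complex.exp (-(Real.pi * (z + j / (k + 1 : ℕ)) * Complex.I)) := by
      rw [← Complex.exp_add]
      congr 1
      ring
    have h3 : Complex.exp (-(Real.pi * (z + j / (k + 1 : ℕ)) * Complex.I)) *
        Complex.exp (Real.pi * (z + j / (k + 1 : ℕ)) * Complex.I) = 1 := by
      rw [← Complex.exp_add]; simp
    rw [mul_assoc (Complex.I / 2), h2, h1, Complex.sin, neg_mul]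
    linear_combination (Complex.I / 2) *
      Complex.exp (Real.pi * (z + j / (k + 1 : ℕ)) * Complex.I) * h3
  have hexp : ∏ j ∈ range (k + 1), Complex.exp (-(Real.pi * Complex.I / (k + 1 : ℕ)) * j) =
      (-Complex.I) ^ k := by
    have hsum : (∑ j ∈ range (k + 1), (j : ℂ)) * 2 = (k + 1 : ℕ) * k := by
      have h := congrArg (Nat.cast : ℕ → ℂ) (Finset.sum_range_id_mul_two (k + 1))
      rw [Nat.add_sub_cancel] at h
      push_cast at h ⊢
      exact h
    rw [← Complex.exp_sum, ← mul_sum, ← Complex.exp_neg_pi_div_two_mul_I, ← Complex.exp_nat_mul]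
    congr 1
    rw [show (∑ j ∈ range (k + 1), (j : ℂ)) = (k + 1 : ℕ) * k / 2 by rw [← hsum]; ring]
    field_simp
  rw [prod_congr rfl hfac, prod_mul_distrib, prod_mul_distrib, hroots, hexp, prod_const, card_range,
    Complex.sin, mul_pow, ← Complex.exp_nat_mul]
  have h4 : w ^ (k + 1) = Complex.exp (Real.pi * ((k + 1 : ℕ) * z) * Complex.I) *
      Complex.exp (Real.pi * ((k + 1 : ℕ) * z) * Complex.I) := by
    rw [hw, ← Complex.exp_nat_mul, ← Complex.exp_add]
    congr 1
    ring
  have h5 : Complex.exp (((k + 1 : ℕ) : ℂ) * -(Real.pi * z * Complex.I)) =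
      Complex.exp (-(Real.pi * ((k + 1 : ℕ) * z)) * Complex.I) := by
    congr 1
    ring
  have h6 : Complex.exp (-(Real.pi * ((k + 1 : ℕ) * z)) * Complex.I) *
        Complex.exp (Real.pi * ((k + 1 : ℕ) * z) * Complex.I) = 1 := by
      rw [← Complex.exp_add]; simp
  have h7 : (Complex.I / 2) ^ (k + 1) * (-Complex.I) ^ k = 2 / 2 ^ (k + 1) * (Complex.I / 2) := by
    rw [div_pow, pow_succ, neg_pow]
    have : Complex.I ^ k * ((-1) ^ k * Complex.I ^ k) = 1 := by
      rw [mul_left_comm, ← mul_pow, ← mul_pow]; simp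
    linear_combination (Complex.I / (2 ^ (k + 1))) * this
  rw [h5, h4]
  linear_combination
    (Complex.exp (-(Real.pi * ((k + 1 : ℕ) * z)) * Complex.I) -
      Complex.exp (Real.pi * ((k + 1 : ℕ) * z) * Complex.I)) * h7 -
    (Complex.I / 2) ^ (k + 1) * (-Complex.I) ^ k *
      Complex.exp (Real.pi * ((k + 1 : ℕ) * z) * Complex.I) * h6

open Finset in
theorem prod_sin_pi_mul_succ_div (k : ℕ) :
    ∏ i ∈ range k, Real.sin (Real.pi * ((i + 1 : ℝ) / (k + 1))) = (k + 1) / 2 ^ k := by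
  have hprim : IsPrimitiveRoot (Complex.exp (2 * Real.pi * Complex.I / (k + 1 : ℕ))) (k + 1) :=
    Complex.isPrimitiveRoot_exp _ (Nat.succ_ne_zero k)
  have h := congrArg norm hprim.prod_one_sub_pow_eq_order
  rw [norm_prod] at h
  have hk : ‖(k : ℂ) + 1‖ = k + 1 := by
    have := Complex.norm_natCast (k + 1)
    push_cast at this
    exact this
  rw [hk] at h
  have hf : ∀ i ∈ range k, ‖1 - Complex.exp (2 * Real.pi * Complex.I / (k + 1 : ℕ)) ^ (i + 1)‖ =
      2 * Real.sin (Real.pi * ((i + 1 : ℝ) / (k + 1))) := by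
    intro i hi
    have hik : (i : ℝ) + 1 ≤ k + 1 := by
      have := (mem_range.mp hi).le
      exact_mod_cast Nat.succ_le_succ this
    rw [← Complex.exp_nat_mul, norm_sub_rev,
      show ((i + 1 : ℕ) : ℂ) * (2 * Real.pi * Complex.I / (k + 1 : ℕ)) =
        Complex.I * ((2 * (Real.pi * ((i + 1 : ℝ) / (k + 1))) : ℝ) : ℂ) by push_cast; ring,
      Complex.norm_exp_I_mul_ofReal_sub_one, mul_div_cancel_left₀ _ two_ne_zero, Real.norm_eq_abs,
      abs_of_nonneg]
    refine mul_nonneg two_pos.le (Real.sin_nonneg_of_nonneg_of_le_pi (by positivity) ?_)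
    exact mul_le_of_le_one_right Real.pi_pos.le (div_le_one_of_le₀ hik (by positivity))
  rw [prod_congr rfl hf, prod_mul_distrib, prod_const, card_range] at h
  rw [eq_div_iff (by positivity), mul_comm, h]

open Finset in
theorem prod_Gamma_succ_div_sq (k : ℕ) :
    (∏ i ∈ range (k + 1), Real.Gamma ((1 + i : ℝ) / (k + 1 : ℕ))) ^ 2 =
      (2 * Real.pi) ^ k / (k + 1) := by
  have hk : (k : ℝ) + 1 ≠ 0 := by positivity
  have hlast : ∏ i ∈ range (k + 1), Real.Gamma ((1 + i : ℝ) / (k + 1 : ℕ)) =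
      ∏ i ∈ range k, Real.Gamma ((i + 1 : ℝ) / (k + 1)) := by
    rw [prod_range_succ]
    push_cast
    rw [add_comm (1 : ℝ) k, div_self hk, Real.Gamma_one, mul_one]
    exact prod_congr rfl fun i _ => by rw [add_comm (1 : ℝ)]
  -- pairing `i` with `k - 1 - i` makes the reflection formula applicable to the square
  have hrefl : ∏ i ∈ range k, Real.Gamma ((i + 1 : ℝ) / (k + 1)) =
      ∏ i ∈ range k, Real.Gamma (1 - (i + 1 : ℝ) / (k + 1)) := by
    rw [← prod_range_reflect]
    refine prod_congr rfl fun i hi => ?_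
    have hi' := mem_range.mp hi
    rw [show ((k - 1 - i : ℕ) : ℝ) = (k : ℝ) - 1 - i by
      rw [Nat.sub_sub, Nat.cast_sub (by omega)]; push_cast; ring]
    congr 1
    field_simp
    ring
  rw [hlast, sq]
  nth_rewrite 2 [hrefl]
  rw [← prod_mul_distrib, prod_congr rfl fun i _ => Real.Gamma_mul_Gamma_one_sub _,
    prod_div_distrib, prod_sin_pi_mul_succ_div, prod_const, card_range, mul_pow]
  field_simp

open Finset in
/-- Gauss's multiplication formula on the positive reals. The function
`s ↦ n ^ s ∏ Γ((s + j) / n)` is log-convex and satisfies the functional equation of `Γ`, so it is a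
multiple of `Γ` by the Bohr–Mollerup theorem; the reflection formula gives the constant. -/
theorem prod_realGamma_add_div {n : ℕ} (hn : 0 < n) {s : ℝ} (hs : 0 < s) :
    ∏ j ∈ range n, Real.Gamma ((s + j) / n) =
      (2 * Real.pi) ^ (((n : ℝ) - 1) / 2) * (n : ℝ) ^ (1 / 2 - s) * Real.Gamma s := by
  have hn' : (0 : ℝ) < n := by exact_mod_cast hn
  set P : ℝ → ℝ := fun s => ∏ j ∈ range n, Real.Gamma ((s + j) / n) with hP
  have hΓpos : ∀ {y : ℝ}, 0 < y → ∀ j : ℕ, 0 < Real.Gamma ((y + j) / n) := fun hy j =>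
    Real.Gamma_pos_of_pos (by positivity)
  have hPpos : ∀ {y : ℝ}, 0 < y → 0 < P y := fun hy => prod_pos fun j _ => hΓpos hy j
  have hPfeq : ∀ {y : ℝ}, 0 < y → P (y + 1) = y / n * P y := by
    intro y hy
    have h1 : P (y + 1) * Real.Gamma ((y + (0 : ℕ)) / n) = P y * Real.Gamma ((y + n) / n) := by
      have h2 := prod_range_succ (fun j : ℕ => Real.Gamma ((y + j) / n)) n
      rw [prod_range_succ'] at h2
      rw [← h2, hP]
      congr 1
      refine prod_congr rfl fun j _ => ?_
      congr 2
      push_cast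
      ring
    rw [show (y + n) / n = y / n + 1 by field_simp, Real.Gamma_add_one (by positivity),
      Nat.cast_zero, add_zero] at h1
    have h3 : Real.Gamma (y / n) ≠ 0 := (Real.Gamma_pos_of_pos (by positivity)).ne'
    apply mul_right_cancel₀ h3
    rw [h1]
    ring
  have hP1 : P 1 = (2 * Real.pi) ^ (((n : ℝ) - 1) / 2) * (n : ℝ) ^ (-(1 / 2) : ℝ) := by
    obtain ⟨k, rfl⟩ : ∃ k, n = k + 1 := ⟨n - 1, by omega⟩
    have h1 := prod_Gamma_succ_div_sq k
    have h2 : P 1 ^ 2 =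
        ((2 * Real.pi) ^ ((((k + 1 : ℕ) : ℝ) - 1) / 2) *
          ((k + 1 : ℕ) : ℝ) ^ (-(1 / 2) : ℝ)) ^ 2 := by
      rw [hP]
      simp only
      rw [h1, mul_pow _ _ 2, ← Real.rpow_natCast ((2 * Real.pi) ^ ((((k + 1 : ℕ) : ℝ) - 1) / 2)),
        ← Real.rpow_natCast (((k + 1 : ℕ) : ℝ) ^ (-(1 / 2) : ℝ)),
        ← Real.rpow_mul (by positivity), ← Real.rpow_mul (by positivity),
        show (((k + 1 : ℕ) : ℝ) - 1) / 2 * (2 : ℕ) = k by push_cast; ring,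
        show (-(1 / 2) : ℝ) * (2 : ℕ) = -1 by push_cast; ring, Real.rpow_natCast,
        Real.rpow_neg_one, div_eq_mul_inv]
      push_cast
      rfl
    exact (pow_left_inj₀ (hPpos one_pos).le (by positivity) two_ne_zero).mp h2
  have hBM : Set.EqOn (fun s => (n : ℝ) ^ (s - 1) * P s / P 1) Real.Gamma (Set.Ioi 0) := by
    apply Real.eq_Gamma_of_log_convex
    · have hlog : Set.EqOn (Real.log ∘ fun s => (n : ℝ) ^ (s - 1) * P s / P 1)
          (fun s => (∑ j ∈ range n, Real.log (Real.Gamma ((s + j) / n))) + s * Real.log n -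
            (Real.log n + Real.log (P 1))) (Set.Ioi 0) := by
        intro y hy
        have hy : 0 < y := hy
        rw [Function.comp_apply, Real.log_div (by have := hPpos hy; positivity) (hPpos one_pos).ne',
          Real.log_mul (by positivity) (hPpos hy).ne', Real.log_rpow hn',
          show Real.log (P y) = _ from Real.log_prod fun j _ => (hΓpos hy j).ne']
        ring
      have hlin : ConvexOn ℝ (Set.Ioi (0 : ℝ)) fun s : ℝ => s * Real.log n := by
        refine ⟨convex_Ioi 0, fun x _ y _ a b _ _ _ => le_of_eq ?_⟩
        simp only [smul_eq_mul]
        ring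
      have hterm : ∀ j : ℕ, ConvexOn ℝ (Set.Ioi (0 : ℝ))
          fun s => Real.log (Real.Gamma ((s + j) / n)) := by
        intro j
        refine ⟨convex_Ioi 0, fun x hx y hy a b ha hb hab => ?_⟩
        have hx : 0 < x := hx
        have hy : 0 < y := hy
        have h := Real.convexOn_log_Gamma.2 (x := (x + j) / n) (y := (y + j) / n)
          (Set.mem_Ioi.mpr (by positivity)) (Set.mem_Ioi.mpr (by positivity)) ha hb hab
        have harg : (a • x + b • y + j) / n = a • ((x + j) / n) + b • ((y + j) / n) := by
          simp only [smul_eq_mul]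
          field_simp
          linear_combination -(j : ℝ) * hab
        simpa only [harg, Function.comp_apply] using h
      refine ConvexOn.congr (ConvexOn.add_const (ConvexOn.add ?_ hlin) _) hlog.symm
      induction range n using Finset.induction_on with
      | empty => simpa using convexOn_const 0 (convex_Ioi (0 : ℝ))
      | insert i t hi ih => exact ((hterm i).add ih).congr fun x _ => by simp [sum_insert hi]
    · intro y hy
      rw [hPfeq hy, show y + 1 - 1 = (y - 1) + 1 by ring, Real.rpow_add hn', Real.rpow_one]
      field_simp
    · intro y hy
      have := hPpos hy
      have := hPpos one_pos
      positivity
    · simp [(hPpos one_pos).ne']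
  have h := hBM (Set.mem_Ioi.mpr hs)
  simp only at h
  rw [← h, hP1, show (1 / 2 - s : ℝ) = -(1 / 2) - (s - 1) by ring, Real.rpow_sub hn']
  have hc : (0 : ℝ) < (n : ℝ) ^ (-(1 / 2) : ℝ) := by positivity
  have hd : (0 : ℝ) < (n : ℝ) ^ (s - 1) := by positivity
  have he : (0 : ℝ) < (2 * Real.pi) ^ (((n : ℝ) - 1) / 2) := by positivity
  change P s = _
  field_simp

theorem differentiableAt_Gamma_of_re_pos {s : ℂ} (hs : 0 < s.re) :
    DifferentiableAt ℂ Complex.Gamma s :=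
  Complex.differentiableAt_Gamma _ fun m h => by
    rw [h] at hs
    simp only [Complex.neg_re, Complex.natCast_re] at hs
    linarith [Nat.cast_nonneg (α := ℝ) m]

/-- The identity theorem on the right half-plane: a holomorphic function is determined there by its
values on the positive reals. -/
theorem eq_of_eq_ofReal_pos {f g : ℂ → ℂ} (hf : ∀ w : ℂ, 0 < w.re → DifferentiableAt ℂ f w)
    (hg : ∀ w : ℂ, 0 < w.re → DifferentiableAt ℂ g w) (h : ∀ s : ℝ, 0 < s → f s = g s) {z : ℂ}
    (hz : 0 < z.re) : f z = g z := by
  set U : Set ℂ := {w | 0 < w.re} with hU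
  have hUo : IsOpen U := isOpen_lt continuous_const Complex.continuous_re
  have h1 : AnalyticOnNhd ℂ f U :=
    DifferentiableOn.analyticOnNhd (fun w hw => (hf w hw).differentiableWithinAt) hUo
  have h2 : AnalyticOnNhd ℂ g U :=
    DifferentiableOn.analyticOnNhd (fun w hw => (hg w hw).differentiableWithinAt) hUo
  have h3 : Filter.Tendsto ((↑) : ℝ → ℂ) (nhdsWithin 1 {1}ᶜ) (nhdsWithin 1 {1}ᶜ) := by
    rw [tendsto_nhdsWithin_iff]
    constructor
    · exact tendsto_nhdsWithin_of_tendsto_nhds Complex.continuous_ofReal.continuousAt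
    · exact eventually_nhdsWithin_iff.mpr
        (Filter.Eventually.of_forall fun t ht => Complex.ofReal_ne_one.mpr ht)
  refine h1.eqOn_of_preconnected_of_frequently_eq h2 (convex_halfSpace_re_gt 0).isPreconnected
    (z₀ := 1) (by simp [hU]) (h3.frequently (Filter.Eventually.frequently ?_)) hz
  refine Filter.Eventually.filter_mono nhdsWithin_le_nhds ?_
  filter_upwards [eventually_gt_nhds (zero_lt_one (α := ℝ))] with s hs
  exact h s hs

open Finset in
/-- Gauss's multiplication formula on the right half-plane, by analytic continuation from the
positive reals. -/
theorem prod_Gamma_add_div {n : ℕ} (hn : 0 < n) {z : ℂ} (hz : 0 < z.re) :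
    ∏ j ∈ range n, Complex.Gamma ((z + j) / n) =
      (((2 * Real.pi) ^ (((n : ℝ) - 1) / 2) : ℝ) : ℂ) * (n : ℂ) ^ (1 / 2 - z) *
        Complex.Gamma z := by
  have hn' : (0 : ℝ) < n := by exact_mod_cast hn
  have hnc : (n : ℂ) ≠ 0 := by exact_mod_cast hn.ne'
  refine eq_of_eq_ofReal_pos (f := fun w => ∏ j ∈ range n, Complex.Gamma ((w + j) / n))
    (g := fun w => (((2 * Real.pi) ^ (((n : ℝ) - 1) / 2) : ℝ) : ℂ) *
      (n : ℂ) ^ (1 / 2 - w) * Complex.Gamma w) (fun w hw => ?_) (fun w hw => ?_)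
    (fun s hs => ?_) hz
  · refine DifferentiableAt.fun_finsetProd fun j _ => ?_
    have hw' : 0 < ((w + j) / (n : ℂ)).re := by
      rw [← Complex.ofReal_natCast n, Complex.div_ofReal_re, Complex.add_re, Complex.natCast_re]
      positivity
    exact DifferentiableAt.comp w (f := fun w : ℂ => (w + j) / n)
      (differentiableAt_Gamma_of_re_pos hw') (by fun_prop)
  · exact DifferentiableAt.mul (DifferentiableAt.const_mul
      (DifferentiableAt.const_cpow (by fun_prop) (Or.inl hnc)) _)
      (differentiableAt_Gamma_of_re_pos hw)
  · have h := congrArg ((↑) : ℝ → ℂ) (prod_realGamma_add_div hn hs)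
    rw [Complex.ofReal_prod] at h
    rw [← Complex.ofReal_natCast n,
      show (1 / 2 - (s : ℂ)) = ((1 / 2 - s : ℝ) : ℂ) by push_cast; ring,
      ← Complex.ofReal_cpow hn'.le, Complex.Gamma_ofReal, ← Complex.ofReal_mul,
      ← Complex.ofReal_mul, ← h]
    refine prod_congr rfl fun j _ => ?_
    rw [← Complex.Gamma_ofReal]
    push_cast
    rfl

/-! ### The kernel of the Meijer functions -/

section

open Finset

theorem prod_filter_val_lt {R : Type*} [CommMonoid R] (m n : ℕ) (f : Fin (m + n) → R) :
    ∏ j : Fin (m + n) with j.val < m, f j = ∏ j : Fin m, f (Fin.castAdd n j) := by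
  rw [prod_filter, Fin.prod_univ_add]
  simp

theorem prod_filter_le_val {R : Type*} [CommMonoid R] (m n : ℕ) (f : Fin (m + n) → R) :
    ∏ j : Fin (m + n) with m ≤ j.val, f j = ∏ j : Fin n, f (Fin.natAdd m j) := by
  rw [prod_filter, Fin.prod_univ_add]
  have : ∀ j : Fin m, ¬ (m ≤ (j : ℕ)) := fun j => not_le.mpr j.isLt
  simp [this]

/-- The multiplication formula for the list `Δ(n, a)`. -/
theorem prod_Gamma_Δ_add {n : ℕ} (hn : 0 < n) (a s : ℂ) (h : 0 < (n * s + a).re) :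
    ∏ j : Fin n, Complex.Gamma (Δ n a j + s) =
      (((2 * Real.pi) ^ (((n : ℝ) - 1) / 2) : ℝ) : ℂ) * (n : ℂ) ^ (1 / 2 - (n * s + a)) *
        Complex.Gamma (n * s + a) := by
  have hnc : (n : ℂ) ≠ 0 := by exact_mod_cast hn.ne'
  rw [← prod_Gamma_add_div hn h, ← Fin.prod_univ_eq_prod_range
    (fun j : ℕ => Complex.Gamma ((n * s + a + j) / n))]
  refine prod_congr rfl fun j _ => ?_
  congr 1
  rw [Δ]
  field_simp
  ring

/-- The multiplication formula for `1 - Δ(n, 0) - s`, a list that is `Δ(n, 1 - n s)` in reverse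
order. -/
theorem prod_Gamma_one_sub_Δ_sub {n : ℕ} (hn : 0 < n) (s : ℂ) (h : 0 < (1 - n * s).re) :
    ∏ j : Fin n, Complex.Gamma (1 - Δ n 0 j - s) =
      (((2 * Real.pi) ^ (((n : ℝ) - 1) / 2) : ℝ) : ℂ) * (n : ℂ) ^ (1 / 2 - (1 - n * s)) *
        Complex.Gamma (1 - n * s) := by
  have hnc : (n : ℂ) ≠ 0 := by exact_mod_cast hn.ne'
  rw [← prod_Gamma_add_div hn h, ← prod_range_reflect, ← Fin.prod_univ_eq_prod_range
    (fun j : ℕ => Complex.Gamma ((1 - n * s + (n - 1 - j : ℕ)) / n))]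
  refine prod_congr rfl fun j _ => ?_
  congr 1
  have hj : ((n - 1 - (j : ℕ) : ℕ) : ℂ) = n - 1 - (j : ℕ) := by
    rw [Nat.sub_sub, Nat.cast_sub (by omega)]
    push_cast
    ring
  rw [Δ, hj]
  field_simp
  ring

/-- The denominator of the kernel, by the reflection formula. It holds at the poles too, where both
sides are `0` by the conventions on `Γ` and on division. -/
theorem inv_prod_Gamma_one_sub_mul_prod_Gamma {n : ℕ} (hn : 0 < n) (a s : ℂ) :
    ((∏ j : Fin n, Complex.Gamma (1 - Δ n a j - s)) * ∏ j : Fin n, Complex.Gamma (Δ n a j + s))⁻¹ =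
      2 / (2 * Real.pi) ^ n * Complex.sin (Real.pi * (n * s + a)) := by
  have hnc : (n : ℂ) ≠ 0 := by exact_mod_cast hn.ne'
  have h1 : ∀ j : Fin n, Complex.Gamma (1 - Δ n a j - s) * Complex.Gamma (Δ n a j + s) =
      Real.pi / Complex.sin (Real.pi * ((n * s + a) / n + (j : ℕ) / n)) := by
    intro j
    rw [mul_comm, show 1 - Δ n a j - s = 1 - (Δ n a j + s) by ring,
      Complex.Gamma_mul_Gamma_one_sub, Δ]
    congr 3
    field_simp
    ring
  rw [← prod_mul_distrib, prod_congr rfl fun j _ => h1 j, prod_div_distrib,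
    Fin.prod_univ_eq_prod_range
      (fun j : ℕ => Complex.sin (Real.pi * ((n * s + a) / n + (j : ℕ) / n))),
    prod_sin_pi_mul_add_div hn, mul_div_cancel₀ _ hnc, prod_const, card_univ, Fintype.card_fin,
    inv_div, mul_pow]
  have : (Real.pi : ℂ) ≠ 0 := by exact_mod_cast Real.pi_ne_zero
  field_simp

/-- The kernel of the Meijer functions of the series: by Gauss's multiplication formula and the
reflection formula it has just two Gamma factors and a sine. -/
theorem meijerGKernel_series {L m₁ N : ℕ} (hL : 0 < L) (hm₁ : 0 < m₁) (hN : 0 < N)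
    (m M u v : ℝ) (r : ℕ) (s : ℂ) (h1 : 0 < (m₁ * s + ((m / M * r : ℝ) : ℂ)).re)
    (h2 : 0 < (1 - L * s).re) :
    meijerGKernel m₁ L (L + N) (m₁ + N) (upperParams L N m M u v r) (lowerParams m₁ N m M u v r) s =
      (((2 * Real.pi) ^ (((L : ℝ) + m₁) / 2 - 1) : ℝ) : ℂ) * (2 / (2 * Real.pi) ^ N) *
        ((m₁ : ℂ) ^ (1 / 2 - (m₁ * s + ((m / M * r : ℝ) : ℂ))) *
          (L : ℂ) ^ (1 / 2 - (1 - L * s))) *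
        (Complex.Gamma (m₁ * s + ((m / M * r : ℝ) : ℂ)) * Complex.Gamma (1 - L * s) *
          Complex.sin (Real.pi * (N * s + ((-(v - u * (m / M)) * r : ℝ) : ℂ)))) := by
  rw [meijerGKernel, prod_filter_val_lt, prod_filter_val_lt, prod_filter_le_val, prod_filter_le_val]
  simp only [upperParams, lowerParams, Fin.append_left, Fin.append_right]
  rw [div_eq_mul_inv, prod_Gamma_Δ_add hm₁ _ _ h1, prod_Gamma_one_sub_Δ_sub hL _ h2,
    inv_prod_Gamma_one_sub_mul_prod_Gamma hN]
  have h3 : (((2 * Real.pi) ^ (((L : ℝ) + m₁) / 2 - 1) : ℝ) : ℂ) =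
      (((2 * Real.pi) ^ (((m₁ : ℝ) - 1) / 2) : ℝ) : ℂ) *
        (((2 * Real.pi) ^ (((L : ℝ) - 1) / 2) : ℝ) : ℂ) := by
    rw [← Complex.ofReal_mul, ← Real.rpow_add (by positivity)]
    congr 2
    ring
  rw [h3]
  ring

end

/-! ### Decay of the Gamma function and Mellin inversion of the exponential -/

section

open MeasureTheory

theorem integrable_exp_neg_mul_abs {b : ℝ} (hb : 0 < b) :
    Integrable fun y : ℝ => Real.exp (-(b * |y|)) := by
  rw [← integrableOn_univ, ← Set.Iic_union_Ioi (a := (0 : ℝ)), integrableOn_union]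
  constructor
  · refine (integrableOn_exp_mul_Iic hb 0).congr_fun (fun y hy => ?_) measurableSet_Iic
    simp only
    rw [abs_of_nonpos hy]
    congr 1
    ring
  · refine (exp_neg_integrableOn_Ioi 0 hb).congr_fun (fun y hy => ?_) measurableSet_Ioi
    simp only
    rw [abs_of_pos hy]
    congr 1
    ring

theorem integrableOn_rpow_mul_exp_neg_mul {s b : ℝ} (hs : -1 < s) (hb : 0 < b) :
    IntegrableOn (fun x : ℝ => x ^ s * Real.exp (-(b * x))) (Set.Ioi 0) :=
  (integrableOn_rpow_mul_exp_neg_mul_rpow hs one_pos hb).congr_fun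
    (fun x _ => by simp only [Real.rpow_one, neg_mul]) measurableSet_Ioi

theorem norm_cpow_mul_exp_neg_mul {a r : ℂ} {t : ℝ} (ht : 0 < t) :
    ‖(t : ℂ) ^ a * Complex.exp (-(r * t))‖ = t ^ a.re * Real.exp (-(r.re * t)) := by
  rw [norm_mul, Complex.norm_cpow_eq_rpow_re_of_pos ht, Complex.norm_exp, Complex.neg_re,
    Complex.re_mul_ofReal]

theorem integrableOn_cpow_mul_exp_neg_mul {a r : ℂ} (ha : -1 < a.re) (hr : 0 < r.re) :
    IntegrableOn (fun t : ℝ => (t : ℂ) ^ a * Complex.exp (-(r * t))) (Set.Ioi 0) := by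
  refine Integrable.mono' (integrableOn_rpow_mul_exp_neg_mul ha hr) ?_ ?_
  · exact (by fun_prop : Measurable fun t : ℝ =>
      (t : ℂ) ^ a * Complex.exp (-(r * t))).aestronglyMeasurable
  · filter_upwards [ae_restrict_mem measurableSet_Ioi] with t ht
    rw [norm_cpow_mul_exp_neg_mul ht]

/-- The Mellin transform of `e^{-rt}` for complex `r` in the right half-plane, by analytic
continuation in `r` from the positive reals. -/
theorem integral_cpow_mul_exp_neg_mul {a r : ℂ} (ha : 0 < a.re) (hr : 0 < r.re) :
    ∫ t : ℝ in Set.Ioi 0, (t : ℂ) ^ (a - 1) * Complex.exp (-(r * t)) =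
      Complex.Gamma a * r ^ (-a) := by
  refine eq_of_eq_ofReal_pos
    (f := fun r : ℂ => ∫ t : ℝ in Set.Ioi 0, (t : ℂ) ^ (a - 1) * Complex.exp (-(r * t)))
    (g := fun r : ℂ => Complex.Gamma a * r ^ (-a)) (fun w hw => ?_) (fun w hw => ?_)
    (fun s hs => ?_) hr
  · have hmeas : ∀ b r : ℂ, Measurable fun t : ℝ => (t : ℂ) ^ b * Complex.exp (-(r * t)) := by
      intro b r; fun_prop
    -- differentiate under the integral sign on the half-plane `Re z > Re w / 2`
    refine (hasDerivAt_integral_of_dominated_loc_of_deriv_le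
      (s := {z : ℂ | w.re / 2 < z.re}) (μ := volume.restrict (Set.Ioi (0 : ℝ)))
      (F := fun (r : ℂ) (t : ℝ) => (t : ℂ) ^ (a - 1) * Complex.exp (-(r * t)))
      (F' := fun (r : ℂ) (t : ℝ) => -((t : ℂ) ^ a * Complex.exp (-(r * t))))
      (bound := fun t => t ^ a.re * Real.exp (-(w.re / 2 * t))) (x₀ := w)
      ?_ ?_ ?_ ?_ ?_ ?_ ?_).2.differentiableAt
    · exact (isOpen_lt continuous_const Complex.continuous_re).mem_nhds (by
        change w.re / 2 < w.re; linarith)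
    · exact Filter.Eventually.of_forall fun r => (hmeas _ r).aestronglyMeasurable
    · exact integrableOn_cpow_mul_exp_neg_mul (by simpa using ha) hw
    · exact (hmeas _ w).neg.aestronglyMeasurable
    · filter_upwards [ae_restrict_mem measurableSet_Ioi] with t ht z hz
      have ht : 0 < t := ht
      have hz : w.re / 2 < z.re := hz
      rw [norm_neg, norm_cpow_mul_exp_neg_mul ht]
      gcongr
    · exact integrableOn_rpow_mul_exp_neg_mul (by linarith) (by linarith)
    · filter_upwards [ae_restrict_mem measurableSet_Ioi] with t ht z hz
      have ht : 0 < t := ht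
      have h := (((hasDerivAt_id z).mul_const (t : ℂ)).neg.cexp).const_mul ((t : ℂ) ^ (a - 1))
      refine h.congr_deriv ?_
      have htc : (t : ℂ) ≠ 0 := by exact_mod_cast ht.ne'
      rw [Complex.cpow_sub _ _ htc, Complex.cpow_one]
      change _ * (Complex.exp (-(z * t)) * -(1 * (t : ℂ))) = _
      field_simp
  · exact DifferentiableAt.const_mul (DifferentiableAt.cpow_const differentiableAt_id
      (Or.inl hw)) _
  · rw [Complex.integral_cpow_mul_exp_neg_mul_Ioi ha hs, mul_comm, Complex.cpow_neg, one_div,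
      Complex.inv_cpow _ _ (by rw [Complex.arg_ofReal_of_nonneg hs.le]; exact Real.pi_pos.ne)]

theorem exp_mul_I_cpow {φ : ℝ} (hφ : |φ| < Real.pi) (a : ℂ) :
    Complex.exp ((φ : ℂ) * Complex.I) ^ a = Complex.exp ((φ : ℂ) * Complex.I * a) := by
  rw [Complex.cpow_def_of_ne_zero (Complex.exp_ne_zero _), Complex.log_exp]
  · simpa using (abs_lt.mp hφ).1
  · simpa using (abs_lt.mp hφ).2.le

theorem cos_pos_of_abs_lt {φ : ℝ} (hφ : |φ| < Real.pi / 2) : 0 < Real.cos φ :=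
  Real.cos_pos_of_mem_Ioo (abs_lt.mp hφ)

theorem re_exp_mul_I_pos {φ : ℝ} (hφ : |φ| < Real.pi / 2) :
    0 < (Complex.exp ((φ : ℂ) * Complex.I)).re := by
  rw [Complex.exp_ofReal_mul_I_re]
  exact cos_pos_of_abs_lt hφ

/-- `Γ` decays like `e^{-φ|y|}` on vertical lines, for every `φ < π / 2`: rotate the ray of
integration in Euler's integral by the angle `± φ`, that is, take `r = e^{± iφ}` in
`integral_cpow_mul_exp_neg_mul`. -/
theorem exists_norm_Gamma_le {σ φ : ℝ} (hσ : 0 < σ) (hφ0 : 0 ≤ φ) (hφ : φ < Real.pi / 2) :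
    ∃ C : ℝ, 0 ≤ C ∧ ∀ y : ℝ,
      ‖Complex.Gamma ((σ : ℂ) + y * Complex.I)‖ ≤ C * Real.exp (-(φ * |y|)) := by
  have key : ∀ ψ : ℝ, |ψ| < Real.pi / 2 → ∀ y : ℝ,
      ‖Complex.Gamma ((σ : ℂ) + y * Complex.I)‖ * Real.exp (ψ * y) ≤
        ∫ t in Set.Ioi (0 : ℝ), t ^ (σ - 1) * Real.exp (-(Real.cos ψ * t)) := by
    intro ψ hψ y
    have hre : ((σ : ℂ) + y * Complex.I).re = σ := by simp
    have him : ((σ : ℂ) + y * Complex.I).im = y := by simp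
    have h := integral_cpow_mul_exp_neg_mul (a := (σ : ℂ) + y * Complex.I)
      (by rwa [hre]) (re_exp_mul_I_pos hψ)
    rw [exp_mul_I_cpow (by linarith [Real.pi_pos])] at h
    have h2 : ‖Complex.exp ((ψ : ℂ) * Complex.I * -((σ : ℂ) + y * Complex.I))‖ =
        Real.exp (ψ * y) := by
      rw [Complex.norm_exp]
      congr 1
      simp
    rw [← h2, ← norm_mul, ← h]
    refine (norm_integral_le_integral_norm _).trans (le_of_eq ?_)
    refine setIntegral_congr_fun measurableSet_Ioi fun t ht => ?_
    rw [norm_cpow_mul_exp_neg_mul ht, Complex.exp_ofReal_mul_I_re, Complex.sub_re, hre,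
      Complex.one_re]
  refine ⟨∫ t in Set.Ioi (0 : ℝ), t ^ (σ - 1) * Real.exp (-(Real.cos φ * t)), ?_, fun y => ?_⟩
  · refine setIntegral_nonneg measurableSet_Ioi fun t ht => ?_
    have ht : 0 < t := ht
    positivity
  · rw [Real.exp_neg, ← div_eq_mul_inv, le_div_iff₀ (Real.exp_pos _)]
    rcases le_total 0 y with hy | hy
    · rw [abs_of_nonneg hy]
      exact key φ (by rwa [abs_of_nonneg hφ0]) y
    · rw [abs_of_nonpos hy]
      have := key (-φ) (by rwa [abs_neg, abs_of_nonneg hφ0]) y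
      rwa [Real.cos_neg, neg_mul, ← mul_neg] at this

theorem continuous_Gamma_vertical {σ : ℝ} (hσ : 0 < σ) :
    Continuous fun y : ℝ => Complex.Gamma ((σ : ℂ) + y * Complex.I) :=
  continuous_iff_continuousAt.mpr fun y =>
    ContinuousAt.comp (f := fun y : ℝ => (σ : ℂ) + y * Complex.I)
      (differentiableAt_Gamma_of_re_pos (by simpa using hσ)).continuousAt (by fun_prop)

theorem integrable_Gamma_mul_exp {σ φ : ℝ} (hσ : 0 < σ) (hφ : |φ| < Real.pi / 2) :
    Integrable fun y : ℝ => Complex.Gamma ((σ : ℂ) + y * Complex.I) *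
      Complex.exp (-((φ : ℂ) * Complex.I * ((σ : ℂ) + y * Complex.I))) := by
  obtain ⟨ψ, h1, h2⟩ := exists_between hφ
  obtain ⟨C, hC, hle⟩ := exists_norm_Gamma_le hσ ((abs_nonneg φ).trans h1.le) h2
  refine Integrable.mono' ((integrable_exp_neg_mul_abs (sub_pos.mpr h1)).const_mul C)
    ((continuous_Gamma_vertical hσ).mul (by fun_prop)).aestronglyMeasurable ?_
  refine Filter.Eventually.of_forall fun y => ?_
  have h3 : ‖Complex.exp (-((φ : ℂ) * Complex.I * ((σ : ℂ) + y * Complex.I)))‖ =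
      Real.exp (φ * y) := by
    rw [Complex.norm_exp]
    congr 1
    simp
  rw [norm_mul, h3]
  calc _ ≤ C * Real.exp (-(ψ * |y|)) * Real.exp (|φ| * |y|) := by
        rw [← abs_mul]
        gcongr
        · exact hle y
        · exact le_abs_self _
    _ = _ := by
        rw [mul_assoc, ← Real.exp_add]
        congr 2
        ring

/-- Mellin's inversion formula for the exponential function, along the ray of argument `φ`. -/
theorem integral_Gamma_mul_cpow {σ φ r : ℝ} (hσ : 0 < σ) (hφ : |φ| < Real.pi / 2) (hr : 0 < r) :
    1 / (2 * (Real.pi : ℂ)) * ∫ y : ℝ, (r : ℂ) ^ (-((σ : ℂ) + y * Complex.I)) *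
        (Complex.Gamma ((σ : ℂ) + y * Complex.I) *
          Complex.exp (-((φ : ℂ) * Complex.I * ((σ : ℂ) + y * Complex.I)))) =
      Complex.exp (-(r : ℂ) * Complex.exp ((φ : ℂ) * Complex.I)) := by
  set f : ℝ → ℂ := fun t => Complex.exp (-(Complex.exp ((φ : ℂ) * Complex.I) * t)) with hf
  have hmel : ∀ y : ℝ, mellin f ((σ : ℂ) + y * Complex.I) =
      Complex.Gamma ((σ : ℂ) + y * Complex.I) *
        Complex.exp (-((φ : ℂ) * Complex.I * ((σ : ℂ) + y * Complex.I))) := by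
    intro y
    rw [mellin]
    simp only [smul_eq_mul, hf]
    rw [integral_cpow_mul_exp_neg_mul (by simpa using hσ) (re_exp_mul_I_pos hφ),
      exp_mul_I_cpow (by linarith [Real.pi_pos]), mul_neg]
  have h := mellinInv_mellin_eq σ f hr ?_ ?_ ?_
  · rw [mellinInv] at h
    simp only [hmel, smul_eq_mul] at h
    rw [Complex.real_smul] at h
    push_cast at h
    rw [h, hf]
    simp only
    congr 1
    ring
  · have := integrableOn_cpow_mul_exp_neg_mul (a := (σ : ℂ) - 1) (by simpa using hσ)
      (re_exp_mul_I_pos hφ)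
    exact this
  · rw [Complex.VerticalIntegrable]
    simp only [hmel]
    exact integrable_Gamma_mul_exp hσ hφ
  · fun_prop

end

/-! ### The Mellin–Barnes integral -/

noncomputable section

open MeasureTheory

theorem ofReal_rpow_cpow {ω : ℝ} (hω : 0 < ω) (M : ℝ) (a : ℂ) :
    ((ω ^ M : ℝ) : ℂ) ^ a = (ω : ℂ) ^ (M * a) := by
  have h1 : ((ω ^ M : ℝ) : ℂ) ≠ 0 := by exact_mod_cast (Real.rpow_pos_of_pos hω M).ne'
  have h2 : (ω : ℂ) ≠ 0 := by exact_mod_cast hω.ne'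
  rw [Complex.cpow_def_of_ne_zero h1, Complex.cpow_def_of_ne_zero h2, ← Complex.ofReal_log hω.le,
    ← Complex.ofReal_log (Real.rpow_pos_of_pos hω M).le, Real.log_rpow hω]
  push_cast
  ring_nf

/-- The Mellin–Barnes integrand at `w = σ + iy` that represents the Laplace integral
`∫_0^∞ e^{-pω} ω^ν exp (-t ω^M e^{iφ}) dω`. -/
def barnesIntegrand (M φ ν σ t : ℝ) (p : ℂ) (y : ℝ) : ℂ :=
  (t : ℂ) ^ (-((σ : ℂ) + y * Complex.I)) *
    (Complex.Gamma ((σ : ℂ) + y * Complex.I) *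
      Complex.exp (-((φ : ℂ) * Complex.I * ((σ : ℂ) + y * Complex.I)))) *
    (Complex.Gamma (1 + ν - M * ((σ : ℂ) + y * Complex.I)) *
      p ^ (-(1 + ν - M * ((σ : ℂ) + y * Complex.I))))

theorem continuous_Gamma_vertical_affine {M ν σ : ℝ} (hσ : M * σ < 1 + ν) :
    Continuous fun y : ℝ => Complex.Gamma (1 + ν - M * ((σ : ℂ) + y * Complex.I)) :=
  continuous_iff_continuousAt.mpr fun y =>
    ContinuousAt.comp (f := fun y : ℝ => (1 + ν - M * ((σ : ℂ) + y * Complex.I) : ℂ))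
      (differentiableAt_Gamma_of_re_pos (by simpa using hσ)).continuousAt (by fun_prop)

theorem continuous_barnesIntegrand {M φ ν σ t : ℝ} {p : ℂ} (hσ : 0 < σ) (hσ' : M * σ < 1 + ν)
    (ht : 0 < t) (hp : p ≠ 0) : Continuous (barnesIntegrand M φ ν σ t p) := by
  have htc : (t : ℂ) ≠ 0 := by exact_mod_cast ht.ne'
  refine ((Continuous.const_cpow (by fun_prop) (Or.inl htc)).mul
    ((continuous_Gamma_vertical hσ).mul (by fun_prop))).mul
    ((continuous_Gamma_vertical_affine hσ').mul (Continuous.const_cpow (by fun_prop) (Or.inl hp)))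

/-- The bound is uniform in `p` on a horizontal half-line up to the imaginary axis; there
`|p ^ (-(1 + ν - M w))|` can grow like `e^{πM|y|/2}`, which eats up the decay of the second Gamma
factor, while the decay of the first one beats `e^{|φ||y|}`. -/
theorem exists_norm_barnesIntegrand_le {M φ ν σ t x : ℝ} (hM : 0 < M) (hφ : |φ| < Real.pi / 2)
    (hσ : 0 < σ) (hσ' : M * σ < 1 + ν) (ht : 0 < t) (hx : 0 < x) :
    ∃ C b : ℝ, 0 < b ∧ ∀ p : ℂ, 0 ≤ p.re → p.im = x → ∀ y : ℝ,
      ‖barnesIntegrand M φ ν σ t p y‖ ≤ C * Real.exp (-(b * |y|)) := by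
  set A : ℝ := 1 + ν - M * σ with hA
  have hApos : 0 < A := by linarith
  -- `ψ (1 + M) - (π / 2) M - |φ|` must be positive
  have hlt : ((Real.pi / 2) * M + |φ|) / (1 + M) < Real.pi / 2 := by
    rw [div_lt_iff₀ (by positivity)]
    linarith
  obtain ⟨ψ, h1, h2⟩ := exists_between hlt
  have hψ0 : 0 ≤ ψ := by
    refine le_trans ?_ h1.le
    have := Real.pi_pos
    positivity
  rw [div_lt_iff₀ (by positivity)] at h1
  obtain ⟨C₁, hC₁, hle₁⟩ := exists_norm_Gamma_le hσ hψ0 h2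
  obtain ⟨C₂, hC₂, hle₂⟩ := exists_norm_Gamma_le hApos hψ0 h2
  refine ⟨t ^ (-σ) * C₁ * (C₂ * x ^ (-A)), ψ * (1 + M) - (Real.pi / 2 * M + |φ|), by linarith,
    fun p hp0 hpx y => ?_⟩
  have hp : p ≠ 0 := by
    intro h
    rw [h] at hpx
    simp only [Complex.zero_im] at hpx
    linarith
  have harg : (1 + ν - M * ((σ : ℂ) + y * Complex.I)) = ((A : ℂ) + (-(M * y) : ℝ) * Complex.I) := by
    rw [hA]
    push_cast
    ring
  have n1 : ‖(t : ℂ) ^ (-((σ : ℂ) + y * Complex.I))‖ = t ^ (-σ) := by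
    rw [Complex.norm_cpow_eq_rpow_re_of_pos ht]
    simp
  have n2 : ‖Complex.exp (-((φ : ℂ) * Complex.I * ((σ : ℂ) + y * Complex.I)))‖ ≤
      Real.exp (|φ| * |y|) := by
    rw [Complex.norm_exp, ← abs_mul]
    refine Real.exp_le_exp.mpr (le_trans (le_of_eq ?_) (le_abs_self _))
    simp
  have n3 : ‖Complex.Gamma (1 + ν - M * ((σ : ℂ) + y * Complex.I))‖ ≤
      C₂ * Real.exp (-(ψ * (M * |y|))) := by
    rw [harg]
    refine (hle₂ _).trans (le_of_eq ?_)
    rw [abs_neg, abs_mul, abs_of_pos hM]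
  have n4 : ‖p ^ (-(1 + ν - M * ((σ : ℂ) + y * Complex.I)))‖ ≤
      x ^ (-A) * Real.exp (Real.pi / 2 * (M * |y|)) := by
    rw [harg, Complex.norm_cpow_of_ne_zero hp, div_eq_mul_inv, ← Real.exp_neg]
    have hre : (-((A : ℂ) + (-(M * y) : ℝ) * Complex.I)).re = -A := by simp
    have him : (-((A : ℂ) + (-(M * y) : ℝ) * Complex.I)).im = M * y := by simp
    rw [hre, him]
    have hxp : x ≤ ‖p‖ := by
      rw [← hpx]
      exact (le_abs_self _).trans (Complex.abs_im_le_norm p)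
    refine mul_le_mul ?_ (Real.exp_le_exp.mpr ?_) (Real.exp_pos _).le (by positivity)
    · exact Real.rpow_le_rpow_of_nonpos hx hxp (by linarith)
    · refine (neg_le_abs _).trans ?_
      rw [abs_mul, abs_mul, abs_of_pos hM]
      gcongr
      exact Complex.abs_arg_le_pi_div_two_iff.mpr hp0
  rw [barnesIntegrand, norm_mul, norm_mul, norm_mul, norm_mul, n1]
  calc _ ≤ t ^ (-σ) * (C₁ * Real.exp (-(ψ * |y|)) * Real.exp (|φ| * |y|)) *
        (C₂ * Real.exp (-(ψ * (M * |y|))) * (x ^ (-A) * Real.exp (Real.pi / 2 * (M * |y|)))) := by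
        gcongr
        exact hle₁ y
    _ = t ^ (-σ) * C₁ * (C₂ * x ^ (-A)) * (Real.exp (-(ψ * |y|)) * Real.exp (|φ| * |y|) *
        Real.exp (-(ψ * (M * |y|))) * Real.exp (Real.pi / 2 * (M * |y|))) := by ring
    _ = _ := by
        rw [← Real.exp_add, ← Real.exp_add, ← Real.exp_add]
        congr 2
        ring

theorem integrable_barnesIntegrand {M φ ν σ t x : ℝ} (hM : 0 < M) (hφ : |φ| < Real.pi / 2)
    (hσ : 0 < σ) (hσ' : M * σ < 1 + ν) (ht : 0 < t) (hx : 0 < x) {p : ℂ} (hp0 : 0 ≤ p.re)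
    (hpx : p.im = x) : Integrable (barnesIntegrand M φ ν σ t p) := by
  obtain ⟨C, b, hb, hle⟩ := exists_norm_barnesIntegrand_le hM hφ hσ hσ' ht hx
  have hp : p ≠ 0 := by
    intro h
    rw [h] at hpx
    simp only [Complex.zero_im] at hpx
    linarith
  exact Integrable.mono' ((integrable_exp_neg_mul_abs hb).const_mul C)
    (continuous_barnesIntegrand hσ hσ' ht hp).aestronglyMeasurable
    (Filter.Eventually.of_forall (hle p hp0 hpx))

/-- For `Re p > 0` the integral over `ω` of the Mellin–Barnes representation of
`exp (-t ω^M e^{iφ})` converges absolutely and Fubini's theorem applies. -/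
theorem integral_laplace_eq_barnes_of_re_pos {M φ ν σ t : ℝ} (hφ : |φ| < Real.pi / 2)
    (hσ : 0 < σ) (hσ' : M * σ < 1 + ν) (ht : 0 < t) {p : ℂ} (hp : 0 < p.re) :
    ∫ ω in Set.Ioi (0 : ℝ), Complex.exp (-(p * ω)) * ((ω ^ ν : ℝ) : ℂ) *
        Complex.exp (-((t * ω ^ M : ℝ) : ℂ) * Complex.exp ((φ : ℂ) * Complex.I)) =
      1 / (2 * (Real.pi : ℂ)) * ∫ y : ℝ, barnesIntegrand M φ ν σ t p y := by
  set B : ℝ → ℂ := fun y => (t : ℂ) ^ (-((σ : ℂ) + y * Complex.I)) *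
    (Complex.Gamma ((σ : ℂ) + y * Complex.I) *
      Complex.exp (-((φ : ℂ) * Complex.I * ((σ : ℂ) + y * Complex.I)))) with hB
  have htc : (t : ℂ) ≠ 0 := by exact_mod_cast ht.ne'
  have hBc : Continuous B := (Continuous.const_cpow (by fun_prop) (Or.inl htc)).mul
    ((continuous_Gamma_vertical hσ).mul (by fun_prop))
  have hBi : Integrable fun y => ‖B y‖ := by
    have h := ((integrable_Gamma_mul_exp hσ hφ).norm.const_mul (t ^ (-σ)))
    refine h.congr (Filter.Eventually.of_forall fun y => ?_)
    simp only [hB]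
    rw [norm_mul _ (Complex.Gamma _ * _), Complex.norm_cpow_eq_rpow_re_of_pos ht]
    simp
  set F : ℝ → ℝ → ℂ := fun ω y => (ω : ℂ) ^ (ν - M * ((σ : ℂ) + y * Complex.I)) *
    Complex.exp (-(p * ω)) * B y with hF
  have hFi : Integrable (Function.uncurry F)
      ((volume.restrict (Set.Ioi (0 : ℝ))).prod volume) := by
    have hA := integrableOn_rpow_mul_exp_neg_mul (s := ν - M * σ) (b := p.re) (by linarith) hp
    refine Integrable.mono' (Integrable.mul_prod hA hBi) ?_ ?_
    · have hBm : Measurable fun z : ℝ × ℝ => B z.2 := hBc.measurable.comp measurable_snd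
      have hm : Measurable fun z : ℝ × ℝ => (z.1 : ℂ) ^ (ν - M * ((σ : ℂ) + z.2 * Complex.I)) *
          Complex.exp (-(p * z.1)) := by fun_prop
      exact (hm.mul hBm).aestronglyMeasurable
    · have hae : ∀ᵐ z ∂((volume.restrict (Set.Ioi (0 : ℝ))).prod (volume : Measure ℝ)),
          z.1 ∈ Set.Ioi (0 : ℝ) :=
        Measure.quasiMeasurePreserving_fst.ae (ae_restrict_mem measurableSet_Ioi)
      filter_upwards [hae] with z hz
      simp only [Function.uncurry, hF]
      rw [norm_mul, norm_cpow_mul_exp_neg_mul hz]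
      simp
  have hleft : ∀ ω ∈ Set.Ioi (0 : ℝ), Complex.exp (-(p * ω)) * ((ω ^ ν : ℝ) : ℂ) *
        Complex.exp (-((t * ω ^ M : ℝ) : ℂ) * Complex.exp ((φ : ℂ) * Complex.I)) =
      1 / (2 * (Real.pi : ℂ)) * ∫ y, F ω y := by
    intro ω hω
    have hω : 0 < ω := hω
    have hωc : (ω : ℂ) ≠ 0 := by exact_mod_cast hω.ne'
    rw [← integral_Gamma_mul_cpow hσ hφ (by positivity : 0 < t * ω ^ M), mul_left_comm,
      ← integral_const_mul]
    congr 2 with y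
    rw [Complex.ofReal_mul, Complex.mul_cpow_ofReal_nonneg ht.le (by positivity),
      ofReal_rpow_cpow hω, Complex.ofReal_cpow hω.le, hF, hB]
    simp only
    rw [sub_eq_add_neg (ν : ℂ), Complex.cpow_add _ _ hωc, mul_neg (M : ℂ)]
    ring
  have hright : ∀ y, ∫ ω in Set.Ioi (0 : ℝ), F ω y = barnesIntegrand M φ ν σ t p y := by
    intro y
    simp only [hF]
    rw [integral_mul_const]
    have h := integral_cpow_mul_exp_neg_mul (a := 1 + ν - M * ((σ : ℂ) + y * Complex.I))
      (by simpa using hσ') hp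
    rw [show (1 + ν - M * ((σ : ℂ) + y * Complex.I)) - 1 = ν - M * ((σ : ℂ) + y * Complex.I) by
      ring] at h
    rw [h, barnesIntegrand, hB]
    ring
  rw [setIntegral_congr_fun measurableSet_Ioi hleft, integral_const_mul,
    integral_integral_swap hFi]
  simp only [hright]

/-- The limit `p → ix` of `integral_laplace_eq_barnes_of_re_pos`. -/
theorem integral_fourier_eq_barnes {M φ ν σ t x : ℝ} (hM : 0 < M) (hφ : |φ| < Real.pi / 2)
    (hν : 0 ≤ ν) (hσ : 0 < σ) (hσ' : M * σ < 1 + ν) (ht : 0 < t) (hx : 0 < x) :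
    ∫ ω in Set.Ioi (0 : ℝ), Complex.exp (-(((x * ω : ℝ) : ℂ) * Complex.I)) * ((ω ^ ν : ℝ) : ℂ) *
        Complex.exp (-((t * ω ^ M : ℝ) : ℂ) * Complex.exp ((φ : ℂ) * Complex.I)) =
      1 / (2 * (Real.pi : ℂ)) * ∫ y : ℝ, barnesIntegrand M φ ν σ t (x * Complex.I) y := by
  have hc : 0 < Real.cos φ := cos_pos_of_abs_lt hφ
  set P : ℝ → ℂ := fun ε => ε + x * Complex.I with hP
  have hPre : ∀ ε, (P ε).re = ε := fun ε => by simp [hP]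
  have hPim : ∀ ε, (P ε).im = x := fun ε => by simp [hP]
  have hPlim : Filter.Tendsto P (nhdsWithin 0 (Set.Ioi 0)) (nhds (x * Complex.I)) := by
    have : Continuous P := by fun_prop
    have h := (this.tendsto 0).mono_left (nhdsWithin_le_nhds (s := Set.Ioi 0))
    simpa [hP] using h
  have h1 : Filter.Tendsto (fun ε : ℝ => ∫ ω in Set.Ioi (0 : ℝ), Complex.exp (-(P ε * ω)) *
        ((ω ^ ν : ℝ) : ℂ) *
        Complex.exp (-((t * ω ^ M : ℝ) : ℂ) * Complex.exp ((φ : ℂ) * Complex.I)))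
      (nhdsWithin 0 (Set.Ioi 0))
      (nhds (∫ ω in Set.Ioi (0 : ℝ), Complex.exp (-(((x * ω : ℝ) : ℂ) * Complex.I)) *
        ((ω ^ ν : ℝ) : ℂ) *
        Complex.exp (-((t * ω ^ M : ℝ) : ℂ) * Complex.exp ((φ : ℂ) * Complex.I)))) := by
    refine tendsto_integral_filter_of_dominated_convergence
      (fun ω => ω ^ ν * Real.exp (-(t * Real.cos φ) * ω ^ M)) ?_ ?_ ?_ ?_
    · refine Filter.Eventually.of_forall fun ε => Measurable.aestronglyMeasurable ?_
      fun_prop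
    · filter_upwards [self_mem_nhdsWithin] with ε hε
      filter_upwards [ae_restrict_mem measurableSet_Ioi] with ω hω
      have hω : 0 < ω := hω
      have hε : 0 < ε := hε
      rw [norm_mul, norm_mul, Complex.norm_exp, Complex.norm_exp, Complex.norm_real,
        Real.norm_of_nonneg (by positivity), Complex.neg_re, Complex.re_mul_ofReal, hPre,
        ← Complex.ofReal_neg, Complex.re_ofReal_mul, Complex.exp_ofReal_mul_I_re]
      have : Real.exp (-(ε * ω)) ≤ 1 := Real.exp_le_one_iff.mpr (by nlinarith)
      calc _ ≤ 1 * ω ^ ν * Real.exp (-(t * ω ^ M) * Real.cos φ) := by gcongr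
        _ = _ := by rw [one_mul]; ring_nf
    · exact integrableOn_rpow_mul_exp_neg_mul_rpow (by linarith) hM (by positivity)
    · refine Filter.Eventually.of_forall fun ω => ?_
      refine (Filter.Tendsto.mul_const _ ?_).mul_const _
      have h : Filter.Tendsto (fun ε => Complex.exp (-(P ε * ω))) (nhdsWithin 0 (Set.Ioi 0))
          (nhds (Complex.exp (-(x * Complex.I * ω)))) :=
        (Complex.continuous_exp.tendsto _).comp (hPlim.mul_const _).neg
      convert h using 3
      push_cast
      ring
  have h2 : Filter.Tendsto (fun ε : ℝ => ∫ y : ℝ, barnesIntegrand M φ ν σ t (P ε) y)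
      (nhdsWithin 0 (Set.Ioi 0))
      (nhds (∫ y : ℝ, barnesIntegrand M φ ν σ t (x * Complex.I) y)) := by
    obtain ⟨C, b, hb, hle⟩ := exists_norm_barnesIntegrand_le hM hφ hσ hσ' ht hx
    refine tendsto_integral_filter_of_dominated_convergence
      (fun y => C * Real.exp (-(b * |y|))) ?_ ?_ ((integrable_exp_neg_mul_abs hb).const_mul C) ?_
    · filter_upwards [self_mem_nhdsWithin] with ε hε
      exact (integrable_barnesIntegrand hM hφ hσ hσ' ht hx (by rw [hPre]; exact (le_of_lt hε))
        (hPim ε)).aestronglyMeasurable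
    · filter_upwards [self_mem_nhdsWithin] with ε hε
      exact Filter.Eventually.of_forall (hle _ (by rw [hPre]; exact (le_of_lt hε)) (hPim ε))
    · refine Filter.Eventually.of_forall fun y => ?_
      refine Filter.Tendsto.const_mul _ (Filter.Tendsto.const_mul _ ?_)
      refine Filter.Tendsto.cpow hPlim tendsto_const_nhds ?_
      rw [Complex.mem_slitPlane_iff]
      right
      simpa using hx.ne'
  refine tendsto_nhds_unique h1 ((h2.const_mul (1 / (2 * (Real.pi : ℂ)))).congr' ?_)
  filter_upwards [self_mem_nhdsWithin] with ε hε
  exact (integral_laplace_eq_barnes_of_re_pos hφ hσ hσ' ht (by rw [hPre]; exact hε)).symm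

/-- The integrand of the Mellin–Barnes integral with a sine, at `w = σ + iy`. -/
def sineIntegrand (M u ν κ σ t x : ℝ) (y : ℝ) : ℂ :=
  (t : ℂ) ^ (-((σ : ℂ) + y * Complex.I)) *
    (x : ℂ) ^ (-(1 + ν - M * ((σ : ℂ) + y * Complex.I))) *
    (Complex.Gamma ((σ : ℂ) + y * Complex.I) *
      Complex.Gamma (1 + ν - M * ((σ : ℂ) + y * Complex.I)) *
      Complex.sin (Real.pi * (u * ((σ : ℂ) + y * Complex.I) - κ)))

theorem conj_ofReal_cpow {x : ℝ} (hx : 0 < x) (s : ℂ) :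
    (starRingEnd ℂ) ((x : ℂ) ^ s) = (x : ℂ) ^ (starRingEnd ℂ s) := by
  rw [Complex.cpow_conj _ _ (by rw [Complex.arg_ofReal_of_nonneg hx.le]; exact Real.pi_pos.ne),
    Complex.conj_ofReal]

theorem ofReal_mul_I_cpow {x : ℝ} (hx : 0 < x) (s : ℂ) :
    ((x : ℂ) * Complex.I) ^ s = (x : ℂ) ^ s * Complex.exp (Real.pi / 2 * Complex.I * s) := by
  have hxc : (x : ℂ) ≠ 0 := by exact_mod_cast hx.ne'
  rw [Complex.cpow_def_of_ne_zero (mul_ne_zero hxc Complex.I_ne_zero),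
    Complex.cpow_def_of_ne_zero hxc, Complex.log_ofReal_mul hx Complex.I_ne_zero, Complex.log_I,
    Complex.ofReal_log hx.le, ← Complex.exp_add]
  congr 1
  ring

/-- The real part of `integral_fourier_eq_barnes`. With `φ = π (M - 2u) / 2` the integrand is a
factor that is conjugate-symmetric in `y`, times `-i e^{iπ(uw - κ)}`; taking the real part replaces
the latter by `sin (π (uw - κ))`. -/
theorem re_integral_fourier_eq_sine {M u ν κ σ t x : ℝ} (hM : 0 < M)
    (hφ : |Real.pi / 2 * (M - 2 * u)| < Real.pi / 2)
    (hν : 0 ≤ ν) (hσ : 0 < σ) (hσ' : M * σ < 1 + ν) (ht : 0 < t) (hx : 0 < x) :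
    Integrable (sineIntegrand M u ν κ σ t x) ∧
      (((Complex.exp (((Real.pi / 2 * (ν - 2 * κ) : ℝ) : ℂ) * Complex.I) *
        ∫ ω in Set.Ioi (0 : ℝ), Complex.exp (-(((x * ω : ℝ) : ℂ) * Complex.I)) *
          ((ω ^ ν : ℝ) : ℂ) * Complex.exp (-((t * ω ^ M : ℝ) : ℂ) *
            Complex.exp (((Real.pi / 2 * (M - 2 * u) : ℝ) : ℂ) * Complex.I))).re : ℝ) : ℂ) =
      1 / (2 * (Real.pi : ℂ)) * ∫ y : ℝ, sineIntegrand M u ν κ σ t x y := by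
  set G : ℝ → ℂ := fun y => (t : ℂ) ^ (-((σ : ℂ) + y * Complex.I)) *
    (x : ℂ) ^ (-(1 + ν - M * ((σ : ℂ) + y * Complex.I))) *
    (Complex.Gamma ((σ : ℂ) + y * Complex.I) *
      Complex.Gamma (1 + ν - M * ((σ : ℂ) + y * Complex.I))) with hG
  set e : ℂ := Complex.exp (((Real.pi / 2 * (ν - 2 * κ) : ℝ) : ℂ) * Complex.I) with he
  set K : ℝ → ℂ := fun y =>
    e * barnesIntegrand M (Real.pi / 2 * (M - 2 * u)) ν σ t (x * Complex.I) y with hK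
  have hKi : Integrable K := (integrable_barnesIntegrand hM hφ hσ hσ' ht hx
    (p := x * Complex.I) (by simp) (by simp)).const_mul e
  have hKG : ∀ y : ℝ, K y = G y * (-Complex.I *
      Complex.exp (Real.pi * (u * ((σ : ℂ) + y * Complex.I) - κ) * Complex.I)) := by
    intro y
    have hexp : e * Complex.exp (-(((Real.pi / 2 * (M - 2 * u) : ℝ) : ℂ) * Complex.I *
          ((σ : ℂ) + y * Complex.I))) *
        Complex.exp (Real.pi / 2 * Complex.I * (-(1 + ν - M * ((σ : ℂ) + y * Complex.I)))) =
        -Complex.I * Complex.exp (Real.pi * (u * ((σ : ℂ) + y * Complex.I) - κ) * Complex.I) := by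
      rw [he, ← Complex.exp_neg_pi_div_two_mul_I, ← Complex.exp_add, ← Complex.exp_add,
        ← Complex.exp_add]
      congr 1
      push_cast
      ring
    rw [← hexp, hK, hG]
    simp only [barnesIntegrand]
    rw [ofReal_mul_I_cpow hx]
    ring
  have hconj : ∀ y : ℝ, (starRingEnd ℂ) (K (-y)) = G y * (Complex.I *
      Complex.exp (-(Real.pi * (u * ((σ : ℂ) + y * Complex.I) - κ)) * Complex.I)) := by
    intro y
    rw [hKG, hG]
    simp only [map_mul, conj_ofReal_cpow ht, conj_ofReal_cpow hx, ← Complex.Gamma_conj,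
      ← Complex.exp_conj, map_neg, map_add, map_sub, map_one, Complex.conj_ofReal, Complex.conj_I,
      Complex.ofReal_neg]
    simp only [neg_neg, neg_mul, mul_neg]
  have hKc : Integrable fun y => (starRingEnd ℂ) (K (-y)) :=
    Complex.conjCLE.toContinuousLinearMap.integrable_comp hKi.comp_neg
  have hS : ∀ y, sineIntegrand M u ν κ σ t x y = (K y + (starRingEnd ℂ) (K (-y))) / 2 := by
    intro y
    rw [hconj, hKG, sineIntegrand, hG, Complex.sin]
    ring
  have hSi : Integrable (sineIntegrand M u ν κ σ t x) := by
    rw [show sineIntegrand M u ν κ σ t x = fun y => (K y + (starRingEnd ℂ) (K (-y))) / 2 from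
      funext hS]
    exact (hKi.add hKc).div_const 2
  refine ⟨hSi, ?_⟩
  rw [integral_fourier_eq_barnes hM hφ hν hσ hσ' ht hx, mul_left_comm, ← integral_const_mul]
  change (((1 / (2 * (Real.pi : ℂ)) * ∫ y, K y).re : ℝ) : ℂ) = _
  have hint : ∫ y, sineIntegrand M u ν κ σ t x y =
      ((∫ y, K y) + (starRingEnd ℂ) (∫ y, K y)) / 2 := by
    simp only [hS]
    rw [integral_div, integral_add hKi hKc,
      integral_neg_eq_self (fun y => (starRingEnd ℂ) (K y)), integral_conj]
  rw [hint, Complex.add_conj, show (1 / (2 * (Real.pi : ℂ))) = ((1 / (2 * Real.pi) : ℝ) : ℂ) by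
    push_cast; rfl, Complex.re_ofReal_mul]
  push_cast
  ring

end

/-! ### The series -/

noncomputable section

open MeasureTheory

theorem rpow_le_const_add_mul_rpow {m M δ : ℝ} (hm : 0 < m) (hmM : m < M) (hδ : 0 < δ) :
    ∃ K : ℝ, ∀ ω : ℝ, 0 < ω → ω ^ m ≤ K + δ * ω ^ M := by
  have hMm : 0 < M - m := sub_pos.mpr hmM
  -- the threshold `ω₀ = δ ^ (-1 / (M - m))` solves `δ ω₀ ^ (M - m) = 1`
  refine ⟨(δ⁻¹ ^ (M - m)⁻¹) ^ m, fun ω hω => ?_⟩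
  rcases le_total ω (δ⁻¹ ^ (M - m)⁻¹) with h | h
  · have h1 : ω ^ m ≤ (δ⁻¹ ^ (M - m)⁻¹) ^ m := Real.rpow_le_rpow hω.le h hm.le
    have h2 : 0 ≤ δ * ω ^ M := by positivity
    linarith
  · have h1 : δ⁻¹ ≤ ω ^ (M - m) := by
      have := Real.rpow_le_rpow (by positivity) h hMm.le
      rwa [← Real.rpow_mul (by positivity), inv_mul_cancel₀ hMm.ne', Real.rpow_one] at this
    have h2 : ω ^ M = ω ^ (M - m) * ω ^ m := by rw [← Real.rpow_add hω]; congr 1; ring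
    have h3 : 0 ≤ (δ⁻¹ ^ (M - m)⁻¹) ^ m := by positivity
    have h4 : ω ^ m ≤ δ * ω ^ M := by
      rw [h2, ← mul_assoc]
      refine le_mul_of_one_le_left (by positivity) ?_
      rwa [inv_le_iff_one_le_mul₀' hδ] at h1
    linarith

theorem integrableOn_exp_neg_mul_rpow_mul_exp {m M t c : ℝ} (hm : 0 < m) (hmM : m < M)
    (ht : 0 < t) (hc : 0 < c) :
    IntegrableOn (fun ω : ℝ => Real.exp (-(t * c) * ω ^ M) * Real.exp (t * ω ^ m)) (Set.Ioi 0) := by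
  obtain ⟨K, hK⟩ := rpow_le_const_add_mul_rpow hm hmM (half_pos hc)
  have h := (integrableOn_rpow_mul_exp_neg_mul_rpow (s := 0) (p := M) (b := t * c / 2) (by norm_num)
    (hm.trans hmM) (by positivity)).const_mul (Real.exp (t * K))
  refine Integrable.mono' h (Measurable.aestronglyMeasurable (by fun_prop)) ?_
  filter_upwards [ae_restrict_mem measurableSet_Ioi] with ω hω
  rw [Real.norm_of_nonneg (by positivity), Real.rpow_zero, one_mul, ← Real.exp_add,
    ← Real.exp_add]
  refine Real.exp_le_exp.mpr ?_
  nlinarith [mul_le_mul_of_nonneg_left (hK ω hω) ht.le]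

/-- The integral `e^{iψr} ∫_0^∞ e^{-ixω} ω^{mr} exp (-t ω^M e^{iφ}) dω`. Multiplied by
`(-t)^r / r!` it is the `r`-th term of the expansion of `∫_0^∞ e^{-ixω}
exp (-t ω^M e^{iφ} - t ω^m e^{iψ}) dω` in powers of `ω^m e^{iψ}`. -/
def expansionTerm (M φ m ψ t x : ℝ) (r : ℕ) : ℂ :=
  Complex.exp ((ψ * r : ℝ) * Complex.I) *
    ∫ ω in Set.Ioi (0 : ℝ), Complex.exp (-(((x * ω : ℝ) : ℂ) * Complex.I)) *
      ((ω ^ (m * r) : ℝ) : ℂ) *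
      Complex.exp (-((t * ω ^ M : ℝ) : ℂ) * Complex.exp ((φ : ℂ) * Complex.I))

/-- Expanding the exponential of smaller index and integrating term by term. The dominating function
is `exp (-t cos φ ω^M + t ω^m)`, which is integrable as `m < M`. -/
theorem hasSum_expansionTerm {M m βM βm t x : ℝ} (hm : 0 < m) (hmM : m < M)
    (hβM : |Real.pi / 2 * βM| < Real.pi / 2) (ht : 0 < t) :
    HasSum (fun r : ℕ => 1 / Real.pi * ((-t) ^ r / (r.factorial : ℝ) *
        (expansionTerm M (Real.pi / 2 * βM) m (Real.pi / 2 * βm) t x r).re))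
      (sumDensityPos M βM m βm t x) := by
  set φ : ℝ := Real.pi / 2 * βM with hφ
  set ψ : ℝ := Real.pi / 2 * βm with hψ
  have hc : 0 < Real.cos φ := cos_pos_of_abs_lt hβM
  set F : ℕ → ℝ → ℂ := fun r ω => Complex.exp (-(((x * ω : ℝ) : ℂ) * Complex.I)) *
    Complex.exp (-((t * ω ^ M : ℝ) : ℂ) * Complex.exp ((φ : ℂ) * Complex.I)) *
    ((-((t * ω ^ m : ℝ) : ℂ) * Complex.exp ((ψ : ℂ) * Complex.I)) ^ r / (r.factorial : ℂ)) with hF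
  have hn1 : ∀ ω : ℝ, ‖Complex.exp (-(((x * ω : ℝ) : ℂ) * Complex.I))‖ = 1 := fun ω => by
    rw [← neg_mul, ← Complex.ofReal_neg, Complex.norm_exp_ofReal_mul_I]
  have hn2 : ∀ ω : ℝ, ‖Complex.exp (-((t * ω ^ M : ℝ) : ℂ) * Complex.exp ((φ : ℂ) * Complex.I))‖ =
      Real.exp (-(t * Real.cos φ) * ω ^ M) := fun ω => by
    rw [Complex.norm_exp, ← Complex.ofReal_neg, Complex.re_ofReal_mul,
      Complex.exp_ofReal_mul_I_re]
    congr 1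
    ring
  have hn3 : ∀ ω ∈ Set.Ioi (0 : ℝ),
      ‖-((t * ω ^ m : ℝ) : ℂ) * Complex.exp ((ψ : ℂ) * Complex.I)‖ = t * ω ^ m := fun ω hω => by
    have hω : 0 < ω := hω
    rw [norm_mul, norm_neg, Complex.norm_exp_ofReal_mul_I, mul_one, Complex.norm_real,
      Real.norm_of_nonneg (by positivity)]
  have hexp : ∀ ω : ℝ, HasSum (fun r : ℕ => (t * ω ^ m) ^ r / (r.factorial : ℝ))
      (Real.exp (t * ω ^ m)) := fun ω => by
    rw [Real.exp_eq_exp_ℝ]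
    exact NormedSpace.expSeries_div_hasSum_exp _
  have hsum : HasSum (fun r => ∫ ω in Set.Ioi (0 : ℝ), F r ω)
      (∫ ω in Set.Ioi (0 : ℝ), Complex.exp (-(((x * ω : ℝ) : ℂ) * Complex.I)) *
        Complex.exp (-((t * ω ^ M : ℝ) : ℂ) * Complex.exp ((φ : ℂ) * Complex.I)
          - ((t * ω ^ m : ℝ) : ℂ) * Complex.exp ((ψ : ℂ) * Complex.I))) := by
    refine hasSum_integral_of_dominated_convergence (fun r ω =>
      Real.exp (-(t * Real.cos φ) * ω ^ M) * ((t * ω ^ m) ^ r / (r.factorial : ℝ))) ?_ ?_ ?_ ?_ ?_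
    · exact fun r => Measurable.aestronglyMeasurable (by fun_prop)
    · intro r
      filter_upwards [ae_restrict_mem measurableSet_Ioi] with ω hω
      rw [hF]
      simp only [norm_mul, norm_div, norm_pow, hn1, hn2, hn3 ω hω, one_mul, Complex.norm_natCast]
      exact le_rfl
    · exact Filter.Eventually.of_forall fun ω => (hexp ω).summable.mul_left _
    · simp only [tsum_mul_left, (hexp _).tsum_eq]
      exact integrableOn_exp_neg_mul_rpow_mul_exp hm hmM ht hc
    · refine Filter.Eventually.of_forall fun ω => ?_
      have h : HasSum (fun r : ℕ =>
          (-((t * ω ^ m : ℝ) : ℂ) * Complex.exp ((ψ : ℂ) * Complex.I)) ^ r / (r.factorial : ℂ))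
          (Complex.exp (-((t * ω ^ m : ℝ) : ℂ) * Complex.exp ((ψ : ℂ) * Complex.I))) := by
        rw [Complex.exp_eq_exp_ℂ]
        exact NormedSpace.expSeries_div_hasSum_exp _
      rw [sub_eq_add_neg, Complex.exp_add, ← mul_assoc,
        ← neg_mul ((t * ω ^ m : ℝ) : ℂ)]
      exact h.mul_left _
  have hterm : ∀ r : ℕ, ∫ ω in Set.Ioi (0 : ℝ), F r ω =
      (((-t) ^ r / (r.factorial : ℝ) : ℝ) : ℂ) * expansionTerm M φ m ψ t x r := by
    intro r
    rw [expansionTerm, ← mul_assoc, ← integral_const_mul]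
    refine setIntegral_congr_fun measurableSet_Ioi fun ω hω => ?_
    have hω : 0 < ω := hω
    simp only [hF]
    rw [Real.rpow_mul hω.le, Real.rpow_natCast, mul_pow, ← Complex.exp_nat_mul]
    push_cast
    rw [show (r : ℂ) * (ψ * Complex.I) = ψ * r * Complex.I by ring, neg_pow ((t : ℂ) * _),
      neg_pow (t : ℂ), mul_pow]
    ring
  have hre := (Complex.hasSum_re hsum).mul_left (1 / Real.pi)
  rw [sumDensityPos]
  simp only [hterm, Complex.re_ofReal_mul] at hre
  exact hre

section

variable {L m₁ N : ℕ} {m M u v t x : ℝ}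

/-- Only the first parameter of `Δ(m₁, (m / M) r)` and the last one of `Δ(L, 0)` matter. -/
theorem separatesPoles_series_iff (hL : 0 < L) (hm₁ : 0 < m₁) (r : ℕ) (c : ℝ) :
    SeparatesPoles m₁ L (L + N) (m₁ + N) (upperParams L N m M u v r)
        (lowerParams m₁ N m M u v r) c ↔
      0 < m₁ * c + m / M * r ∧ L * c < 1 := by
  have hL' : (0 : ℝ) < L := by exact_mod_cast hL
  have hm₁' : (0 : ℝ) < m₁ := by exact_mod_cast hm₁
  have hB : ∀ j : Fin m₁, (lowerParams m₁ N m M u v r (Fin.castAdd N j)).re =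
      (m / M * r + (j : ℕ)) / m₁ := by
    intro j
    rw [lowerParams, Fin.append_left, Δ, ← Complex.ofReal_natCast m₁, Complex.div_ofReal_re,
      Complex.add_re, Complex.ofReal_re, Complex.natCast_re]
  have hA : ∀ j : Fin L, (upperParams L N m M u v r (Fin.castAdd N j)).re = (j : ℕ) / L := by
    intro j
    rw [upperParams, Fin.append_left, Δ, ← Complex.ofReal_natCast L, Complex.div_ofReal_re,
      zero_add, Complex.natCast_re]
  constructor
  · rintro ⟨h1, h2⟩
    have h1' := h1 (Fin.castAdd N ⟨0, hm₁⟩) hm₁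
    have h2' := h2 (Fin.castAdd N ⟨L - 1, by omega⟩) (by change L - 1 < L; omega)
    rw [hB] at h1'
    rw [hA] at h2'
    simp only [Nat.cast_zero, add_zero] at h1'
    simp only [Nat.cast_sub (show 1 ≤ L by omega), Nat.cast_one] at h2'
    constructor
    · rw [← neg_div, div_lt_iff₀ hm₁'] at h1'
      linarith
    · rw [sub_div, div_self hL'.ne', sub_sub_cancel, lt_div_iff₀ hL'] at h2'
      linarith
  · rintro ⟨h1, h2⟩
    constructor
    · intro j hj
      obtain ⟨i, rfl⟩ : ∃ i : Fin m₁, j = Fin.castAdd N i := ⟨⟨j, hj⟩, rfl⟩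
      rw [hB, ← neg_div, div_lt_iff₀ hm₁']
      have : (0 : ℝ) ≤ (i : ℕ) := Nat.cast_nonneg _
      linarith
    · intro j hj
      obtain ⟨i, rfl⟩ : ∃ i : Fin L, j = Fin.castAdd N i := ⟨⟨j, hj⟩, rfl⟩
      have hi : ((i : ℕ) : ℝ) + 1 ≤ L := by exact_mod_cast i.isLt
      rw [hA, lt_sub_iff_add_lt, ← lt_sub_iff_add_lt', lt_sub_iff_add_lt, ← lt_sub_iff_add_lt,
        div_lt_iff₀ hL']
      nlinarith

/-- The change of variable `w = m₁ s + (m / M) r` turns the Mellin–Barnes integrand of the Meijer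
function into that of `re_integral_fourier_eq_sine`. -/
theorem meijerGIntegrand_series (hL : 0 < L) (hm₁ : 0 < m₁) (hN : 0 < N) (hM : 0 < M)
    (hLM : (L : ℝ) = M * m₁) (hNu : (N : ℝ) = u * m₁) (ht : 0 < t) (hx : 0 < x) (r : ℕ) {c : ℝ}
    (h1 : 0 < m₁ * c + m / M * r) (h2 : L * c < 1) (y : ℝ) :
    meijerGIntegrand m₁ L (L + N) (m₁ + N)
        (((L : ℝ) ^ L * t ^ m₁ / (x ^ L * (m₁ : ℝ) ^ m₁) : ℝ) : ℂ)
        (upperParams L N m M u v r) (lowerParams m₁ N m M u v r) c y =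
      ((x * (t / m₁) ^ (m / M * r) / Real.sqrt M *
        (2 * (2 * Real.pi) ^ (((L : ℝ) + m₁) / 2 - 1 - N)) : ℝ) : ℂ) *
        sineIntegrand M u (m * r) (v * r) (m₁ * c + m / M * r) t x (m₁ * y) := by
  have hL' : (0 : ℝ) < L := by exact_mod_cast hL
  have hm₁' : (0 : ℝ) < m₁ := by exact_mod_cast hm₁
  have hMc : (M : ℂ) ≠ 0 := by exact_mod_cast hM.ne'
  have hLMc : (L : ℂ) = M * m₁ := by exact_mod_cast congrArg ((↑) : ℝ → ℂ) hLM
  have hNuc : (N : ℂ) = u * m₁ := by exact_mod_cast congrArg ((↑) : ℝ → ℂ) hNu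
  set ρ : ℝ := m / M * r with hρ
  set s : ℂ := (c : ℂ) + y * Complex.I with hs
  have hw : ((m₁ * c + ρ : ℝ) : ℂ) + (m₁ * y : ℝ) * Complex.I = m₁ * s + (ρ : ℂ) := by
    rw [hs]; push_cast; ring
  have hMw : (1 + (m * r : ℝ) - M * (m₁ * s + (ρ : ℂ)) : ℂ) = 1 - L * s := by
    rw [hρ, hLMc]
    push_cast
    field_simp
    ring
  have hsin : (u * (m₁ * s + (ρ : ℂ)) - (v * r : ℝ) : ℂ) =
      N * s + ((-(v - u * (m / M)) * r : ℝ) : ℂ) := by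
    rw [hρ, hNuc]
    push_cast
    ring
  rw [meijerGIntegrand, meijerGKernel_series hL hm₁ hN m M u v r s, sineIntegrand, hw, hMw, hsin]
  rotate_left
  · rw [← hρ, ← hw]
    simpa using h1
  · rw [hs]
    simpa using h2
  -- both sides are powers of positive reals times the same Gamma factors; compare logarithms
  have hpow : (((L : ℝ) ^ L * t ^ m₁ / (x ^ L * (m₁ : ℝ) ^ m₁) : ℝ) : ℂ) ^ (-s) *
      ((m₁ : ℂ) ^ (1 / 2 - (m₁ * s + (ρ : ℂ))) * (L : ℂ) ^ (1 / 2 - (1 - L * s))) =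
      ((x * (t / m₁) ^ ρ / Real.sqrt M : ℝ) : ℂ) *
        ((t : ℂ) ^ (-(m₁ * s + (ρ : ℂ))) * (x : ℂ) ^ (-(1 - L * s))) := by
    have hcpow : ∀ {b : ℝ}, 0 < b → ∀ a : ℂ, (b : ℂ) ^ a = Complex.exp (Real.log b * a) := by
      intro b hb a
      rw [Complex.cpow_def_of_ne_zero (by exact_mod_cast hb.ne'), Complex.ofReal_log hb.le]
    have hK : ((x * (t / m₁) ^ ρ / Real.sqrt M : ℝ) : ℂ) = Complex.exp
        ((Real.log x + (Real.log t - Real.log m₁) * ρ - (Real.log L - Real.log m₁) / 2 : ℝ) :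
          ℂ) := by
      rw [← Complex.ofReal_exp, Real.exp_sub, Real.exp_add, Real.exp_log hx,
        ← Real.log_div ht.ne' hm₁'.ne', ← Real.rpow_def_of_pos (by positivity),
        ← Real.log_div hL'.ne' hm₁'.ne', Real.sqrt_eq_rpow, Real.rpow_def_of_pos hM]
      congr 5
      · rw [hLM, mul_div_cancel_right₀ _ hm₁'.ne']
      · norm_num
    rw [hK, ← Complex.ofReal_natCast m₁, ← Complex.ofReal_natCast L,
      hcpow (by positivity), hcpow hm₁', hcpow hL', hcpow ht, hcpow hx,
      Real.log_div (by positivity) (by positivity), Real.log_mul (by positivity) (by positivity),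
      Real.log_mul (by positivity) (by positivity), Real.log_pow, Real.log_pow, Real.log_pow,
      Real.log_pow, ← Complex.exp_add, ← Complex.exp_add, ← Complex.exp_add, ← Complex.exp_add]
    congr 1
    push_cast
    ring
  have hconst : ((2 * (2 * Real.pi) ^ (((L : ℝ) + m₁) / 2 - 1 - N) : ℝ) : ℂ) =
      (((2 * Real.pi) ^ (((L : ℝ) + m₁) / 2 - 1) : ℝ) : ℂ) * (2 / (2 * Real.pi) ^ N) := by
    rw [Real.rpow_sub (by positivity), Real.rpow_natCast]
    push_cast
    ring
  rw [← hs, Complex.ofReal_mul (x * (t / m₁) ^ ρ / Real.sqrt M), hconst]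
  linear_combination (((2 * Real.pi) ^ (((L : ℝ) + m₁) / 2 - 1) : ℝ) : ℂ) *
    (2 / (2 * Real.pi) ^ N) * (Complex.Gamma (m₁ * s + (ρ : ℂ)) * Complex.Gamma (1 - L * s) *
      Complex.sin (Real.pi * (N * s + ((-(v - u * (m / M)) * r : ℝ) : ℂ)))) * hpow

/-- The integral along every separating line converges and is an explicit multiple of a term of the
expansion, hence independent of the line. -/
theorem meijerGLine_series (hL : 0 < L) (hm₁ : 0 < m₁) (hN : 0 < N) (hm : 0 < m) (hM : 0 < M)
    (hLM : (L : ℝ) = M * m₁) (hNu : (N : ℝ) = u * m₁)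
    (hφ : |Real.pi / 2 * (M - 2 * u)| < Real.pi / 2) (ht : 0 < t) (hx : 0 < x) (r : ℕ) {c : ℝ}
    (hc : SeparatesPoles m₁ L (L + N) (m₁ + N) (upperParams L N m M u v r)
      (lowerParams m₁ N m M u v r) c) :
    Integrable (meijerGIntegrand m₁ L (L + N) (m₁ + N)
        (((L : ℝ) ^ L * t ^ m₁ / (x ^ L * (m₁ : ℝ) ^ m₁) : ℝ) : ℂ)
        (upperParams L N m M u v r) (lowerParams m₁ N m M u v r) c) ∧
      meijerGLine m₁ L (L + N) (m₁ + N)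
        (((L : ℝ) ^ L * t ^ m₁ / (x ^ L * (m₁ : ℝ) ^ m₁) : ℝ) : ℂ)
        (upperParams L N m M u v r) (lowerParams m₁ N m M u v r) c =
      ((x * (t / m₁) ^ (m / M * r) / Real.sqrt M *
        (2 * (2 * Real.pi) ^ (((L : ℝ) + m₁) / 2 - 1 - N)) / m₁ *
        (expansionTerm M (Real.pi / 2 * (M - 2 * u)) m (Real.pi / 2 * (m - 2 * v)) t x r).re : ℝ) :
        ℂ) := by
  have hm₁' : (0 : ℝ) < m₁ := by exact_mod_cast hm₁
  obtain ⟨h1, h2⟩ := (separatesPoles_series_iff hL hm₁ r c).mp hc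
  -- the abscissa `σ = m₁ c + (m / M) r` lies in the strip `0 < σ < (1 + m r) / M`
  have h3 : M * (m₁ * c + m / M * r) < 1 + m * r := by
    rw [mul_add, ← mul_assoc, ← hLM, ← mul_assoc, mul_div_cancel₀ _ hM.ne']
    linarith
  obtain ⟨hi, he⟩ := re_integral_fourier_eq_sine (κ := v * r) hM hφ
    (by positivity : 0 ≤ m * r) h1 h3 ht hx
  have hI := fun y => meijerGIntegrand_series (v := v) hL hm₁ hN hM hLM hNu ht hx r h1 h2 y
  constructor
  · rw [show meijerGIntegrand m₁ L (L + N) (m₁ + N) _ _ _ c = _ from funext hI]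
    exact (hi.comp_mul_left' hm₁'.ne').const_mul _
  · rw [meijerGLine]
    simp only [hI]
    rw [integral_const_mul, Measure.integral_comp_mul_left
      (sineIntegrand M u (m * r) (v * r) (m₁ * c + m / M * r) t x), mul_left_comm,
      Complex.real_smul, mul_left_comm (1 / (2 * (Real.pi : ℂ))), ← he,
      show Real.pi / 2 * (m * r - 2 * (v * r)) = Real.pi / 2 * (m - 2 * v) * r by ring,
      abs_of_pos (inv_pos.mpr hm₁')]
    change _ * (_ * (((expansionTerm M (Real.pi / 2 * (M - 2 * u)) m
      (Real.pi / 2 * (m - 2 * v)) t x r).re : ℝ) : ℂ)) = _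
    rw [← Complex.ofReal_mul, ← Complex.ofReal_mul]
    congr 1
    ring

theorem meijerGWellDefined_series (hL : 0 < L) (hm₁ : 0 < m₁) (hN : 0 < N) (hm : 0 < m)
    (hM : 0 < M) (hLM : (L : ℝ) = M * m₁) (hNu : (N : ℝ) = u * m₁)
    (hφ : |Real.pi / 2 * (M - 2 * u)| < Real.pi / 2) (ht : 0 < t) (hx : 0 < x) (r : ℕ) :
    MeijerGWellDefined m₁ L (L + N) (m₁ + N)
        (((L : ℝ) ^ L * t ^ m₁ / (x ^ L * (m₁ : ℝ) ^ m₁) : ℝ) : ℂ)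
        (upperParams L N m M u v r) (lowerParams m₁ N m M u v r) ∧
      seriesG L m₁ N m M u v t x r =
      ((x * (t / m₁) ^ (m / M * r) / Real.sqrt M *
        (2 * (2 * Real.pi) ^ (((L : ℝ) + m₁) / 2 - 1 - N)) / m₁ *
        (expansionTerm M (Real.pi / 2 * (M - 2 * u)) m (Real.pi / 2 * (m - 2 * v)) t x r).re : ℝ) :
        ℂ) := by
  have hL' : (0 : ℝ) < L := by exact_mod_cast hL
  have hm₁' : (0 : ℝ) < m₁ := by exact_mod_cast hm₁
  have hex : ∃ c : ℝ, SeparatesPoles m₁ L (L + N) (m₁ + N) (upperParams L N m M u v r)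
      (lowerParams m₁ N m M u v r) c := by
    refine ⟨(2 * L : ℝ)⁻¹, (separatesPoles_series_iff hL hm₁ r _).mpr ⟨by positivity, ?_⟩⟩
    rw [mul_inv, mul_left_comm, mul_inv_cancel₀ hL'.ne']
    norm_num
  have hline := fun {c : ℝ} hc => meijerGLine_series (m := m) (v := v) (c := c) hL hm₁ hN hm hM
    hLM hNu hφ ht hx r hc
  have hG : seriesG L m₁ N m M u v t x r = meijerGLine m₁ L (L + N) (m₁ + N)
        (((L : ℝ) ^ L * t ^ m₁ / (x ^ L * (m₁ : ℝ) ^ m₁) : ℝ) : ℂ)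
        (upperParams L N m M u v r) (lowerParams m₁ N m M u v r) hex.choose := by
    rw [seriesG, meijerG, dif_pos hex]
  rw [(hline hex.choose_spec).2] at hG
  exact ⟨⟨hex, fun c hc => ⟨(hline hc).1, (hline hc).2.trans hG.symm⟩⟩, hG⟩

/-- The powers of `2π`, `t`, `m₁` and `M` cancel: a term of the series, times the prefactor, is the
real part of a term of the expansion. -/
theorem prefactor_mul_seriesTerm (hL : 0 < L) (hm₁ : 0 < m₁) (hN : 0 < N) (hm : 0 < m)
    (hM : 0 < M) (hLM : (L : ℝ) = M * m₁) (hNu : (N : ℝ) = u * m₁)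
    (hφ : |Real.pi / 2 * (M - 2 * u)| < Real.pi / 2) (ht : 0 < t) (hx : 0 < x) (r : ℕ) :
    (((m₁ : ℝ) * Real.sqrt M /
        (x * (2 * Real.pi) ^ (((L : ℝ) + m₁) / 2 - u * m₁)) : ℝ) : ℂ) *
      seriesTerm L m₁ N m M u v t x r =
      ((1 / Real.pi * ((-t) ^ r / (r.factorial : ℝ) *
        (expansionTerm M (Real.pi / 2 * (M - 2 * u)) m (Real.pi / 2 * (m - 2 * v)) t x r).re) : ℝ) :
        ℂ) := by
  have hm₁' : (0 : ℝ) < m₁ := by exact_mod_cast hm₁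
  rw [seriesTerm, (meijerGWellDefined_series hL hm₁ hN hm hM hLM hNu hφ ht hx r).2,
    ← Complex.ofReal_mul, ← Complex.ofReal_mul]
  congr 1
  have h1 : ((m₁ : ℝ) / t) ^ (m / M * r) * (t / m₁) ^ (m / M * r) = 1 := by
    rw [← Real.mul_rpow (by positivity) (by positivity), div_mul_div_cancel₀ ht.ne',
      div_self hm₁'.ne', Real.one_rpow]
  have h2 : (2 * Real.pi) ^ (((L : ℝ) + m₁) / 2 - 1 - N) =
      (2 * Real.pi) ^ (((L : ℝ) + m₁) / 2 - u * m₁) / (2 * Real.pi) := by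
    rw [← hNu, show ((L : ℝ) + m₁) / 2 - 1 - N = ((L : ℝ) + m₁) / 2 - N - 1 by ring,
      Real.rpow_sub_one (by positivity)]
  have h3 : 0 < Real.sqrt M := Real.sqrt_pos.mpr hM
  have h4 : (0 : ℝ) < (2 * Real.pi) ^ (((L : ℝ) + m₁) / 2 - u * m₁) := by positivity
  rw [h2]
  generalize (2 * Real.pi) ^ (((L : ℝ) + m₁) / 2 - u * m₁) = Q at *
  generalize ((m₁ : ℝ) / t) ^ (m / M * r) = R at *
  generalize (t / (m₁ : ℝ)) ^ (m / M * r) = S at *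
  generalize (expansionTerm M (Real.pi / 2 * (M - 2 * u)) m
    (Real.pi / 2 * (m - 2 * v)) t x r).re = E at *
  have hπ := Real.pi_pos
  field_simp
  linear_combination (-t) ^ r * E * h1

end

end

theorem sumDensityPos_comm (α₁ β₁ α₂ β₂ t x : ℝ) :
    sumDensityPos α₁ β₁ α₂ β₂ t x = sumDensityPos α₂ β₂ α₁ β₁ t x := by
  simp only [sumDensityPos, sub_eq_add_neg, neg_mul]
  simp only [add_comm]

/-- `H₊` is the sum of the series, which converges absolutely because the expansion it comes from
does. -/
theorem sumDensityPos_eq_series {L m₁ N : ℕ} {m M u v t x : ℝ} (hL : 0 < L) (hm₁ : 0 < m₁)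
    (hN : 0 < N) (hm : 0 < m) (hmM : m < M) (hLM : (L : ℝ) = M * m₁) (hNu : (N : ℝ) = u * m₁)
    (hφ : |Real.pi / 2 * (M - 2 * u)| < Real.pi / 2) (ht : 0 < t) (hx : 0 < x) :
    Summable (seriesTerm L m₁ N m M u v t x) ∧
      ((sumDensityPos M (M - 2 * u) m (m - 2 * v) t x : ℝ) : ℂ) =
        (((m₁ : ℝ) * Real.sqrt M /
            (x * (2 * Real.pi) ^ (((L : ℝ) + m₁) / 2 - u * m₁)) : ℝ) : ℂ) *
          ∑' r : ℕ, seriesTerm L m₁ N m M u v t x r := by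
  have hM : 0 < M := hm.trans hmM
  have hm₁' : (0 : ℝ) < m₁ := by exact_mod_cast hm₁
  have hs := Complex.hasSum_ofReal.mpr
    (hasSum_expansionTerm (βm := m - 2 * v) (x := x) hm hmM hφ ht)
  simp only [← prefactor_mul_seriesTerm (v := v) hL hm₁ hN hm hM hLM hNu hφ ht hx] at hs
  have hne : (((m₁ : ℝ) * Real.sqrt M /
      (x * (2 * Real.pi) ^ (((L : ℝ) + m₁) / 2 - u * m₁)) : ℝ) : ℂ) ≠ 0 := by
    have := Real.sqrt_pos.mpr hM
    exact_mod_cast (by positivity : (0 : ℝ) < (m₁ : ℝ) * Real.sqrt M /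
      (x * (2 * Real.pi) ^ (((L : ℝ) + m₁) / 2 - u * m₁))).ne'
  exact ⟨(summable_mul_left_iff hne).mp hs.summable, by rw [← hs.tsum_eq, tsum_mul_left]⟩

/-! ### The convolution of the two densities -/

section

open MeasureTheory FourierTransform

/-- The Fourier transform on `L²`, which Mathlib defines by extension from Schwartz functions, is
the Fourier integral on `L¹ ∩ L²`: both define the same tempered distribution. -/
theorem fourier_toLp_ae_eq {f : ℝ → ℂ} (hf : Integrable f) (hf2 : MemLp f 2) :
    (𝓕 (hf2.toLp f) : Lp ℂ 2 (volume : Measure ℝ)) =ᵐ[volume] 𝓕 f := by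
  have hcont : Continuous (𝓕 f) :=
    VectorFourier.fourierIntegral_continuous Real.continuous_fourierChar
      (by exact continuous_inner) hf
  refine ae_eq_of_integral_contDiff_smul_eq
    ((Lp.memLp (𝓕 (hf2.toLp f) : Lp ℂ 2 (volume : Measure ℝ))).locallyIntegrable (by norm_num))
    hcont.locallyIntegrable fun g hg hgs => ?_
  have hg' : ContDiff ℝ (⊤ : ℕ∞) (fun x => (g x : ℂ)) := Complex.ofRealCLM.contDiff.comp hg
  have hgs' : HasCompactSupport (fun x => (g x : ℂ)) := hgs.comp_left Complex.ofReal_zero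
  set ψ : SchwartzMap ℝ ℂ := hgs'.toSchwartzMap hg' with hψ
  have h := congrArg (fun T => T ψ) (Lp.fourier_toTemperedDistribution_eq (hf2.toLp f))
  simp only [TemperedDistribution.fourier_apply, Lp.toTemperedDistribution_apply] at h
  have h1 : ∫ x, (𝓕 ψ : SchwartzMap ℝ ℂ) x • (hf2.toLp f : ℝ → ℂ) x =
      ∫ x, (𝓕 (ψ : ℝ → ℂ)) x • f x := by
    refine integral_congr_ae ?_
    filter_upwards [hf2.coeFn_toLp] with x hx
    rw [hx, SchwartzMap.fourier_coe]
  have h2 : ∫ x, (𝓕 (ψ : ℝ → ℂ)) x • f x = ∫ x, (ψ : ℝ → ℂ) x • (𝓕 f) x := by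
    have := VectorFourier.integral_fourierIntegral_smul_eq_flip (μ := (volume : Measure ℝ))
      (ν := (volume : Measure ℝ)) (L := innerₗ ℝ) Real.continuous_fourierChar
      (by exact continuous_inner) (ψ.integrable) hf
    rw [flip_innerₗ] at this
    exact this
  rw [h1, h2] at h
  have h3 : ∀ x, ψ x = (g x : ℂ) := fun x => rfl
  simp only [h3, smul_eq_mul] at h
  simp only [Complex.real_smul]
  exact h.symm

/-- Parseval's identity for functions in `L¹ ∩ L²`. -/
theorem integral_conj_fourier_mul_fourier {f g : ℝ → ℂ} (hf : Integrable f) (hf2 : MemLp f 2)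
    (hg : Integrable g) (hg2 : MemLp g 2) :
    ∫ y, (starRingEnd ℂ) (𝓕 f y) * 𝓕 g y = ∫ y, (starRingEnd ℂ) (f y) * g y := by
  have h := Lp.inner_fourier_eq (hf2.toLp f) (hg2.toLp g)
  rw [L2.inner_def, L2.inner_def] at h
  have h1 : ∫ y, (starRingEnd ℂ) (𝓕 f y) * 𝓕 g y = ∫ y, inner ℂ
      ((𝓕 (hf2.toLp f) : Lp ℂ 2 (volume : Measure ℝ)) y)
      ((𝓕 (hg2.toLp g) : Lp ℂ 2 (volume : Measure ℝ)) y) := by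
    refine integral_congr_ae ?_
    filter_upwards [fourier_toLp_ae_eq hf hf2, fourier_toLp_ae_eq hg hg2] with y hy1 hy2
    rw [hy1, hy2, RCLike.inner_apply, mul_comm]
  rw [h1, h]
  refine integral_congr_ae ?_
  filter_upwards [hf2.coeFn_toLp, hg2.coeFn_toLp] with y hy1 hy2
  rw [hy1, hy2, RCLike.inner_apply, mul_comm]

/-- The convolution of two Fourier transforms is the Fourier transform of the product. Only
`L¹ ∩ L²` is assumed, so the transforms themselves need not be integrable. -/
theorem integral_fourier_mul_fourier_sub {f g : ℝ → ℂ} (hf : Integrable f) (hf2 : MemLp f 2)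
    (hg : Integrable g) (hg2 : MemLp g 2) (x : ℝ) :
    ∫ y, 𝓕 f y * 𝓕 g (x - y) = 𝓕 (fun ξ => f ξ * g ξ) x := by
  -- Parseval's identity is applied to `f` and the `h` with `conj (𝓕 h y) = 𝓕 g (x - y)`
  set h : ℝ → ℂ := fun ξ =>
    Complex.exp ((2 * Real.pi * ξ * x : ℝ) * Complex.I) * (starRingEnd ℂ) (g ξ) with hh
  have hnorm : ∀ ξ, ‖h ξ‖ = ‖g ξ‖ := fun ξ => by
    rw [hh]
    simp only [norm_mul, Complex.norm_exp_ofReal_mul_I, one_mul, RCLike.norm_conj]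
  have hmeas : AEStronglyMeasurable h volume :=
    (Continuous.aestronglyMeasurable (by fun_prop)).mul
      (Complex.continuous_conj.comp_aestronglyMeasurable hg.1)
  have hi : Integrable h := hg.mono hmeas (Filter.Eventually.of_forall fun ξ => (hnorm ξ).le)
  have hi2 : MemLp h 2 := hg2.mono hmeas (Filter.Eventually.of_forall fun ξ => (hnorm ξ).le)
  have hF : ∀ y, (starRingEnd ℂ) (𝓕 h y) = 𝓕 g (x - y) := by
    intro y
    rw [Real.fourier_real_eq_integral_exp_smul, Real.fourier_real_eq_integral_exp_smul,
      ← integral_conj]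
    refine integral_congr_ae (Filter.Eventually.of_forall fun ξ => ?_)
    simp only [hh, smul_eq_mul, map_mul, ← Complex.exp_conj, Complex.conj_ofReal, Complex.conj_I,
      Complex.conj_conj]
    rw [← mul_assoc, ← Complex.exp_add]
    congr 2
    push_cast
    ring
  have hP := integral_conj_fourier_mul_fourier hi hi2 hf hf2
  simp only [hF] at hP
  rw [Real.fourier_real_eq_integral_exp_smul]
  refine (integral_congr_ae (Filter.Eventually.of_forall fun y => mul_comm _ _)).trans
    (hP.trans (integral_congr_ae (Filter.Eventually.of_forall fun ξ => ?_)))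
  simp only [hh, smul_eq_mul, map_mul, ← Complex.exp_conj, Complex.conj_ofReal, Complex.conj_I,
    Complex.conj_conj]
  rw [mul_assoc, mul_comm (g ξ)]
  congr 2
  push_cast
  ring

theorem measurable_real_sign : Measurable Real.sign := by
  unfold Real.sign
  exact Measurable.ite measurableSet_Iio measurable_const
    (Measurable.ite measurableSet_Ioi measurable_const measurable_const)

theorem Admissible.index_pos {α β : ℝ} (h : Admissible α β) : 0 < α := by
  rcases h with h | h <;> linarith [h.1]

/-- For an admissible pair `|β| < 1`, so `Re e^{iπβ/2} > 0` and the characteristic function decays.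
-/
theorem Admissible.abs_skewness_lt {α β : ℝ} (h : Admissible α β) :
    |Real.pi / 2 * β| < Real.pi / 2 := by
  have hβ : |β| < 1 := by
    rcases h with h | h <;> linarith [h.1, h.2.1, h.2.2]
  rw [abs_mul, abs_of_pos (by positivity)]
  exact mul_lt_of_lt_one_right (by positivity) hβ

section stableChar

variable {α β t : ℝ}

theorem stableChar_of_pos {ω : ℝ} (hω : 0 < ω) :
    stableChar α β t ω = Complex.exp (-((t * ω ^ α : ℝ) : ℂ) *
      Complex.exp (((Real.pi / 2 * β : ℝ) : ℂ) * Complex.I)) := by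
  rw [stableChar, abs_of_pos hω, Real.sign_of_pos hω, mul_one]

theorem conj_stableChar_neg (ω : ℝ) :
    (starRingEnd ℂ) (stableChar α β t (-ω)) = stableChar α β t ω := by
  simp only [stableChar, ← Complex.exp_conj, map_mul, map_neg, Complex.conj_ofReal,
    Complex.conj_I, abs_neg, Real.sign_neg, mul_neg, Complex.ofReal_neg, neg_mul, neg_neg]

theorem norm_stableChar (ω : ℝ) :
    ‖stableChar α β t ω‖ =
      Real.exp (-(t * |ω| ^ α) * Real.cos (Real.pi / 2 * β * Real.sign ω)) := by
  rw [stableChar, Complex.norm_exp, ← Complex.ofReal_neg, Complex.re_ofReal_mul,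
    Complex.exp_ofReal_mul_I_re]

theorem measurable_stableChar : Measurable (stableChar α β t) := by
  have := measurable_real_sign
  unfold stableChar
  fun_prop

theorem norm_stableChar_le_one (hβ : |Real.pi / 2 * β| < Real.pi / 2) (ht : 0 < t)
    (ω : ℝ) : ‖stableChar α β t ω‖ ≤ 1 := by
  rw [norm_stableChar, Real.exp_le_one_iff, neg_mul, neg_nonpos]
  refine mul_nonneg (by positivity) ?_
  have hc : 0 ≤ Real.cos (Real.pi / 2 * β) := (cos_pos_of_abs_lt hβ).le
  rcases Real.sign_apply_eq ω with h | h | h <;> rw [h]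
  · simpa using hc
  · simp
  · simpa using hc

theorem integrable_stableChar (hβ : |Real.pi / 2 * β| < Real.pi / 2) (ht : 0 < t)
    (hα : 0 < α) : Integrable (stableChar α β t) := by
  have hc : 0 < Real.cos (Real.pi / 2 * β) := cos_pos_of_abs_lt hβ
  have hpos : IntegrableOn (stableChar α β t) (Set.Ioi 0) := by
    refine Integrable.mono' (integrableOn_rpow_mul_exp_neg_mul_rpow (s := 0) (p := α)
      (b := t * Real.cos (Real.pi / 2 * β)) (by norm_num) hα (by positivity))
      measurable_stableChar.aestronglyMeasurable ?_
    filter_upwards [ae_restrict_mem measurableSet_Ioi] with ω hω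
    have hω : 0 < ω := hω
    rw [norm_stableChar, Real.rpow_zero, one_mul, abs_of_pos hω, Real.sign_of_pos hω, mul_one]
    exact le_of_eq (by ring_nf)
  have hneg : IntegrableOn (stableChar α β t) (Set.Iio 0) := by
    have h := (Complex.conjCLE.toContinuousLinearMap.integrable_comp hpos)
    have h2 := ((Measure.measurePreserving_neg (volume : Measure ℝ)).integrableOn_comp_preimage
      (Homeomorph.neg ℝ).measurableEmbedding (s := Set.Ioi 0)).mpr h
    rw [Set.neg_preimage, Set.neg_Ioi, neg_zero] at h2
    refine h2.congr_fun (fun ω _ => ?_) measurableSet_Iio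
    exact conj_stableChar_neg ω
  rw [← integrableOn_univ, ← Set.Iic_union_Ioi (a := (0 : ℝ)), integrableOn_union]
  exact ⟨(integrableOn_Iic_iff_integrableOn_Iio).2 hneg, hpos⟩

theorem integrable_and_memLp_two_stableChar (hβ : |Real.pi / 2 * β| < Real.pi / 2) (ht : 0 < t)
    (hα : 0 < α) :
    Integrable (fun ξ => stableChar α β t (2 * Real.pi * ξ)) ∧
      MemLp (fun ξ => stableChar α β t (2 * Real.pi * ξ)) 2 := by
  have hi : Integrable (fun ξ => stableChar α β t (2 * Real.pi * ξ)) :=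
    (integrable_stableChar hβ ht hα).comp_mul_left' (by positivity)
  refine ⟨hi, (memLp_two_iff_integrable_sq_norm hi.1).mpr (hi.norm.mono' (hi.1.norm.pow 2)
    (Filter.Eventually.of_forall fun ξ => ?_))⟩
  rw [Real.norm_of_nonneg (by positivity), sq]
  exact mul_le_of_le_one_left (norm_nonneg _) (norm_stableChar_le_one hβ ht _)

end stableChar

theorem fourier_comp_two_pi_mul (c : ℝ → ℂ) (x : ℝ) :
    𝓕 (fun ξ => c (2 * Real.pi * ξ)) x = 1 / (2 * (Real.pi : ℂ)) *
      ∫ ω : ℝ, Complex.exp (-(((ω * x : ℝ) : ℂ) * Complex.I)) * c ω := by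
  rw [Real.fourier_real_eq_integral_exp_smul]
  have h := Measure.integral_comp_mul_left
    (fun ω : ℝ => Complex.exp (-(((ω * x : ℝ) : ℂ) * Complex.I)) * c ω) (2 * Real.pi)
  rw [abs_of_pos (by positivity), Complex.real_smul] at h
  push_cast at h
  rw [one_div]
  push_cast
  rw [← h]
  refine integral_congr_ae (Filter.Eventually.of_forall fun ξ => ?_)
  simp only [smul_eq_mul]
  congr 2
  ring

/-- A conjugate-symmetric function has a real integral, given by one half-line. -/
theorem integral_eq_two_mul_re_of_conj_neg {f : ℝ → ℂ} (hf : Integrable f)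
    (h : ∀ ω, (starRingEnd ℂ) (f (-ω)) = f ω) :
    ∫ ω, f ω = ((2 * (∫ ω in Set.Ioi (0 : ℝ), f ω).re : ℝ) : ℂ) := by
  have hneg : ∫ ω in Set.Iic (0 : ℝ), f ω = (starRingEnd ℂ) (∫ ω in Set.Ioi (0 : ℝ), f ω) := by
    rw [← neg_zero, ← integral_comp_neg_Ioi, neg_zero, ← integral_conj]
    refine setIntegral_congr_fun measurableSet_Ioi fun ω _ => ?_
    rw [← h (-ω), neg_neg]
  rw [← intervalIntegral.integral_Iic_add_Ioi hf.integrableOn hf.integrableOn (b := 0), hneg,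
    add_comm, Complex.add_conj]

theorem ofReal_stableDensity {α β t : ℝ} (hβ : |Real.pi / 2 * β| < Real.pi / 2) (ht : 0 < t)
    (hα : 0 < α) (x : ℝ) :
    (stableDensity α β t x : ℂ) = 𝓕 (fun ξ => stableChar α β t (2 * Real.pi * ξ)) x := by
  rw [fourier_comp_two_pi_mul, stableDensity, integral_eq_two_mul_re_of_conj_neg]
  · rw [show (1 / (2 * (Real.pi : ℂ))) = ((1 / (2 * Real.pi) : ℝ) : ℂ) by push_cast; rfl,
      ← Complex.ofReal_mul, Complex.ofReal_re]
  · refine (integrable_stableChar hβ ht hα).bdd_mul (c := 1)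
      (Continuous.aestronglyMeasurable (by fun_prop)) (Filter.Eventually.of_forall fun ω => ?_)
    rw [← neg_mul, ← Complex.ofReal_neg, Complex.norm_exp_ofReal_mul_I]
  · intro ω
    rw [map_mul, conj_stableChar_neg, ← Complex.exp_conj]
    simp

/-- The density of the sum is the half-line integral `H₊`: by the convolution theorem it is the
inverse Fourier transform of the product of the characteristic functions, which is conjugate-symmetric. -/
theorem sumDensity_eq_sumDensityPos {α₁ β₁ α₂ β₂ t : ℝ} (h₁ : Admissible α₁ β₁)
    (h₂ : Admissible α₂ β₂) (ht : 0 < t) (x : ℝ) :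
    sumDensity α₁ β₁ α₂ β₂ t x = sumDensityPos α₁ β₁ α₂ β₂ t x := by
  have hβ₁ := h₁.abs_skewness_lt
  have hβ₂ := h₂.abs_skewness_lt
  obtain ⟨i1, m1⟩ := integrable_and_memLp_two_stableChar hβ₁ ht h₁.index_pos
  obtain ⟨i2, m2⟩ := integrable_and_memLp_two_stableChar hβ₂ ht h₂.index_pos
  have hconv := integral_fourier_mul_fourier_sub i1 m1 i2 m2 x
  simp only [← ofReal_stableDensity hβ₁ ht h₁.index_pos,
    ← ofReal_stableDensity hβ₂ ht h₂.index_pos, ← Complex.ofReal_mul] at hconv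
  rw [integral_complex_ofReal, fourier_comp_two_pi_mul
    (fun ω => stableChar α₁ β₁ t ω * stableChar α₂ β₂ t ω),
    integral_eq_two_mul_re_of_conj_neg] at hconv
  · apply Complex.ofReal_injective
    rw [sumDensity, hconv, sumDensityPos,
      show (1 / (2 * (Real.pi : ℂ))) = ((1 / (2 * Real.pi) : ℝ) : ℂ) by push_cast; rfl,
      ← Complex.ofReal_mul]
    congr 1
    rw [← mul_assoc, show 1 / (2 * Real.pi) * 2 = 1 / Real.pi by field_simp]
    congr 2
    refine setIntegral_congr_fun measurableSet_Ioi fun ω hω => ?_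
    rw [stableChar_of_pos hω, stableChar_of_pos hω, ← Complex.exp_add, mul_comm ω x]
    congr 2
    ring
  · refine Integrable.bdd_mul (c := 1) ?_
      (Continuous.aestronglyMeasurable (by fun_prop)) (Filter.Eventually.of_forall fun ω => ?_)
    · exact (integrable_stableChar hβ₂ ht h₂.index_pos).bdd_mul (c := 1)
        measurable_stableChar.aestronglyMeasurable
        (Filter.Eventually.of_forall fun ω => norm_stableChar_le_one hβ₁ ht ω)
    · rw [← neg_mul, ← Complex.ofReal_neg, Complex.norm_exp_ofReal_mul_I]
  · intro ω
    rw [map_mul, map_mul, conj_stableChar_neg, conj_stableChar_neg, ← Complex.exp_conj]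
    simp

end

end TwoScaleStable

theorem mainTheorem3
    (l k p q : ℕ) (a b : ℤ) (hl : 0 < l) (hk : 0 < k) (hp : 0 < p) (hq : 0 < q)
    (α₁ β₁ α₂ β₂ : ℝ)
    (hα₁ : α₁ = (l : ℝ) / k) (hβ₁ : β₁ = ((l : ℝ) - 2 * a) / k)
    (hα₂ : α₂ = (p : ℝ) / q) (hβ₂ : β₂ = ((p : ℝ) - 2 * b) / q)
    (hadm₁ : TwoScaleStable.Admissible α₁ β₁) (hadm₂ : TwoScaleStable.Admissible α₂ β₂)
    (m M u v : ℝ) (m₁ N : ℕ)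
    (hm : m = min α₁ α₂) (hM : M = max α₁ α₂) (hm₁ : m₁ = min (k * p) (l * q))
    (huv : (α₂ < α₁ ∧ u = (a : ℝ) / k ∧ v = (b : ℝ) / q) ∨
      (α₁ < α₂ ∧ u = (b : ℝ) / q ∧ v = (a : ℝ) / k))
    (hu : 0 < u) (hN : (N : ℝ) = u * m₁)
    (t x : ℝ) (ht : 0 < t) (hx : 0 < x) :
    TwoScaleStable.sumDensity α₁ β₁ α₂ β₂ t x =
        TwoScaleStable.sumDensityPos α₁ β₁ α₂ β₂ t x ∧
      (∀ r : ℕ, TwoScaleStable.MeijerGWellDefined m₁ (l * p) (l * p + N) (m₁ + N)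
        (((((l * p : ℕ) : ℝ) ^ (l * p) * t ^ m₁ / (x ^ (l * p) * (m₁ : ℝ) ^ m₁) : ℝ)) : ℂ)
        (TwoScaleStable.upperParams (l * p) N m M u v r)
        (TwoScaleStable.lowerParams m₁ N m M u v r)) ∧
      Summable (TwoScaleStable.seriesTerm (l * p) m₁ N m M u v t x) ∧
      ((TwoScaleStable.sumDensityPos α₁ β₁ α₂ β₂ t x : ℝ) : ℂ) =
        (((m₁ : ℝ) * Real.sqrt M /
            (x * (2 * Real.pi) ^ ((((l * p : ℕ) : ℝ) + m₁) / 2 - u * m₁)) : ℝ) : ℂ) *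
          ∑' r : ℕ, TwoScaleStable.seriesTerm (l * p) m₁ N m M u v t x r := by
  have hk' : (0 : ℝ) < k := by exact_mod_cast hk
  have hq' : (0 : ℝ) < q := by exact_mod_cast hq
  have hL : 0 < l * p := Nat.mul_pos hl hp
  have hm₁pos : 0 < m₁ := by
    rw [hm₁]
    exact lt_min (Nat.mul_pos hk hp) (Nat.mul_pos hl hq)
  have hNpos : 0 < N := by
    have h : (0 : ℝ) < N := by
      rw [hN]
      have : (0 : ℝ) < m₁ := by exact_mod_cast hm₁pos
      positivity
    exact_mod_cast h
  refine ⟨TwoScaleStable.sumDensity_eq_sumDensityPos hadm₁ hadm₂ ht x, ?_⟩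
  rcases huv with ⟨hlt, hu', hv'⟩ | ⟨hlt, hu', hv'⟩
  · rw [min_eq_right hlt.le] at hm
    rw [max_eq_left hlt.le] at hM
    have hle : k * p ≤ l * q := by
      rw [hα₁, hα₂, div_lt_div_iff₀ hq' hk'] at hlt
      have h : p * k < l * q := by exact_mod_cast hlt
      rw [mul_comm k p]
      exact h.le
    rw [min_eq_left hle] at hm₁
    have hLM : ((l * p : ℕ) : ℝ) = M * m₁ := by
      rw [hM, hα₁, hm₁]
      push_cast
      field_simp
    have hβM : β₁ = M - 2 * u := by
      rw [hβ₁, hM, hα₁, hu']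
      ring
    have hβm : β₂ = m - 2 * v := by
      rw [hβ₂, hm, hα₂, hv']
      ring
    have hφ := hadm₁.abs_skewness_lt
    have hmpos := hadm₂.index_pos
    rw [hβM] at hφ
    rw [← hm] at hmpos
    rw [← hm, ← hM] at hlt
    rw [hβM, hβm, ← hm, ← hM]
    exact ⟨fun r => (TwoScaleStable.meijerGWellDefined_series hL hm₁pos hNpos hmpos
      (hmpos.trans hlt) hLM hN hφ ht hx r).1,
      TwoScaleStable.sumDensityPos_eq_series hL hm₁pos hNpos hmpos hlt hLM hN hφ ht hx⟩
  · rw [min_eq_left hlt.le] at hm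
    rw [max_eq_right hlt.le] at hM
    have hle : l * q ≤ k * p := by
      rw [hα₁, hα₂, div_lt_div_iff₀ hk' hq'] at hlt
      have h : l * q < p * k := by exact_mod_cast hlt
      rw [mul_comm k p]
      exact h.le
    rw [min_eq_right hle] at hm₁
    have hLM : ((l * p : ℕ) : ℝ) = M * m₁ := by
      rw [hM, hα₂, hm₁]
      push_cast
      field_simp
    have hβM : β₂ = M - 2 * u := by
      rw [hβ₂, hM, hα₂, hu']
      ring
    have hβm : β₁ = m - 2 * v := by
      rw [hβ₁, hm, hα₁, hv']
      ring
    have hφ := hadm₂.abs_skewness_lt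
    have hmpos := hadm₁.index_pos
    rw [hβM] at hφ
    rw [← hm] at hmpos
    rw [← hm, ← hM] at hlt
    rw [TwoScaleStable.sumDensityPos_comm, hβM, hβm, ← hm, ← hM]
    exact ⟨fun r => (TwoScaleStable.meijerGWellDefined_series hL hm₁pos hNpos hmpos
      (hmpos.trans hlt) hLM hN hφ ht hx r).1,
      TwoScaleStable.sumDensityPos_eq_series hL hm₁pos hNpos hmpos hlt hLM hN hφ ht hx⟩
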